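/- **Setting.** An Ising model $p$ on $V=\{1,\dots,n\}$ with parameters $\theta^p_v$ ($v\in V$) and $\theta^p_{uv}$ ($u\ne v$, unordered pairs; $\theta^p_{uv}=0$ means that the edge is absent) is the distribution on $\{\pm1\}^n$ with $p(x)\propto\exp\big(\sum_v\theta^p_vx_v+\sum_{\{u,v\}}\theta^p_{uv}x_ux_v\big)$. It is in the high-temperature regime with gap $\eta>0$ if $\sum_{u\ne v}\tanh|\theta^p_{uv}|\le 1-\eta$ for every $v$. Write $\mu^p_v=\mathbf E_p[X_v]$, $\mu^p_{uv}=\mathbf E_p[X_uX_v]$, and $d_{\mathrm{SKL}}(p,q)=d_{\mathrm{KL}}(p\|q)+d_{\mathrm{KL}}(q\|p)$. A $\mathrm{Rademacher}(s)$ variable is $+1$ with probability $s$ and $-1$ otherwise. **The learn-then-test algorithm** gets the marginals of a reference model $q$ and i.i.d. samples of an unknown $p$, and runs the following stage first with the observables $g_v=X_v$ ($v\in V$) and then, on fresh samples, with the observables $g_{uv}=X_uX_v$ (pairs $\{u,v\}$). It outputs "far" if one of the two stages rejects and "$p=q$" otherwise. A stage for observables $(g_i)_i$ with reference means $m_i=\mathbf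 E_q[g_i]$ has integer parameters (numbers of samples and repetitions) and two real parameters (an accuracy and a threshold), and uses disjoint sets of samples in its steps: 1. *Localization.* Reject if the empirical mean of some $g_i$ deviates from $m_i$ by at least the accuracy parameter. 2. *Weak learning.* In each of $L$ rounds draw $k$ fresh samples. For each sample and each $i$ draw an independent $Y_i\sim\mathrm{Rademacher}(1/2+m_i/2)$ and put $Z_i=(g_i-Y_i)/2$ if $g_i\ne Y_i$, and a fair $\pm1$ coin otherwise. Let $\Gamma_i$ be the sign of the sum of the $Z_i$ over the $k$ samples, and a fair coin if the sum is $0$. 3. *Testing.* Draw several batches of samples, the same for all $L$ sign vectors. For a sign vector $\Gamma$ and a batch let $Z$ be the empirical mean over the batch of $\sum_i\Gamma_i(g_i-m_i)$. Reject if for some learnt $\Gamma$ more than half of the batches have $Z$ above the threshold. **Theorem.** For every $\eta>0$ there are constants $C>0$ and $\kappa\in\mathbb N$, depending only on $\eta$, such that for all $n\ge0$, $\varepsilon>0$, $h\ge0$, $\beta\ge0$ the parameters of the learn-then-test algorithm can be chosen, as functions of $\eta,n,\varepsilon,h,\beta$ only, so that each stage has $L\le C\,n^{1/3}$ rounds,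 the total number of samples drawn from $p$ is at most $$C\,\log^{\kappa}(n+2)\left(1+\frac{n^{5/3}h^2+n^{11/3}\beta^2}{\varepsilon^2}\right),$$ and the following holds for all Ising models $p,q$ on $n$ nodes in the high-temperature regime with gap $\eta$, under arbitrary external fields, such that $|\theta_v|\le h$ and $|\theta_{uv}|\le\beta$ for all parameters of both models: if $p=q$, the algorithm outputs "$p=q$" with probability at least $9/10$; if $d_{\mathrm{SKL}}(p,q)\ge\varepsilon$, it outputs "far" with probability at least $9/10$. -/

import Mathlib

open MeasureTheory InformationTheory
open scoped ENNReal

noncomputable section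

namespace IsingTest

/-! ### Ising models -/

/-- A spin configuration on `n` nodes; `true` is the spin `+1` and `false` the spin `-1`. -/
abbrev Config (n : ℕ) : Type := Fin n → Bool

/-- The numerical value `±1` of a spin. -/
def spin (b : Bool) : ℝ := if b then 1 else -1

/-- The unordered pairs of distinct nodes, represented by their increasing enumeration. -/
abbrev Edge (n : ℕ) : Type := {e : Fin n × Fin n // e.1 < e.2}

/-- The parameter vector of an Ising model on the nodes `Fin n`. Every pair of distinct nodes is an
edge; a zero parameter means that the edge is absent. -/
structure IsingModel (n : ℕ) where
  /-- the external fields `θ_v` -/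
  node : Fin n → ℝ
  /-- the interactions `θ_{uv}` -/
  edge : Edge n → ℝ

/-- The spin of a node, as an observable. -/
def nodeObs {n : ℕ} (v : Fin n) (x : Config n) : ℝ := spin (x v)

/-- The product of the two spins of an edge, as an observable. -/
def edgeObs {n : ℕ} (e : Edge n) (x : Config n) : ℝ := spin (x e.1.1) * spin (x e.1.2)

namespace IsingModel

variable {n : ℕ}

/-- `∑_v θ_v x_v + ∑_{uv} θ_{uv} x_u x_v` -/
def exponent (p : IsingModel n) (x : Config n) : ℝ :=
  ∑ v, p.node v * nodeObs v x + ∑ e, p.edge e * edgeObs e x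

/-- The normalizing constant, that is, the exponential of the log-partition function. -/
def partition (p : IsingModel n) : ℝ := ∑ x : Config n, Real.exp (p.exponent x)

theorem partition_pos (p : IsingModel n) : 0 < p.partition :=
  Finset.sum_pos (fun _ _ => Real.exp_pos _) Finset.univ_nonempty

theorem sum_prob (p : IsingModel n) :
    ∑ x : Config n, ENNReal.ofReal (Real.exp (p.exponent x) / p.partition) = 1 := by
  rw [← ENNReal.ofReal_sum_of_nonneg
    (fun x _ => div_nonneg (Real.exp_pos _).le p.partition_pos.le), ← Finset.sum_div]
  have h : (∑ x : Config n, Real.exp (p.exponent x)) / p.partition = 1 :=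
    div_self p.partition_pos.ne'
  rw [h, ENNReal.ofReal_one]

/-- The probability mass function of the Ising model. -/
def pmf (p : IsingModel n) : PMF (Config n) :=
  PMF.ofFintype (fun x => ENNReal.ofReal (Real.exp (p.exponent x) / p.partition)) p.sum_prob

/-- The Ising model as a probability distribution on configurations. -/
def law (p : IsingModel n) : Measure (Config n) := p.pmf.toMeasure

instance (p : IsingModel n) : IsProbabilityMeasure p.law :=
  inferInstanceAs (IsProbabilityMeasure p.pmf.toMeasure)

/-- The node marginal `μ_v = E[X_v]`. -/
def nodeMean (p : IsingModel n) (v : Fin n) : ℝ := ∫ x, nodeObs v x ∂p.law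

/-- The edge marginal `μ_{uv} = E[X_u X_v]`. -/
def edgeMean (p : IsingModel n) (e : Edge n) : ℝ := ∫ x, edgeObs e x ∂p.law

/-- Dobrushin's uniqueness condition with gap `η`: for every node `v`,
`∑_{u ≠ v} tanh |θ_{uv}| ≤ 1 - η`. -/
def HighTemperature (p : IsingModel n) (η : ℝ) : Prop :=
  ∀ v : Fin n,
    ∑ e ∈ Finset.univ.filter (fun e : Edge n => e.1.1 = v ∨ e.1.2 = v), Real.tanh |p.edge e|
      ≤ 1 - η

/-- All external fields are at most `h`, and all interactions at most `β`, in absolute value. -/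
def BoundedBy (p : IsingModel n) (h β : ℝ) : Prop :=
  (∀ v, |p.node v| ≤ h) ∧ ∀ e, |p.edge e| ≤ β

end IsingModel

/-- The symmetrized Kullback-Leibler divergence. -/
def dSKL {Ω : Type*} [MeasurableSpace Ω] (P Q : Measure Ω) : ℝ≥0∞ := klDiv P Q + klDiv Q P

/-- The law of a random spin that is `+1` with probability `s ∈ [0, 1]` and `-1` otherwise. -/
def rademacher (s : ℝ) : Measure Bool :=
  ENNReal.ofReal s • Measure.dirac true + ENNReal.ofReal (1 - s) • Measure.dirac false

theorem rademacher_isProbabilityMeasure {s : ℝ} (h0 : 0 ≤ s) (h1 : s ≤ 1) :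
    IsProbabilityMeasure (rademacher s) := by
  constructor
  simp only [rademacher, Measure.coe_add, Measure.coe_smul, Pi.add_apply, Pi.smul_apply,
    measure_univ, smul_eq_mul, mul_one]
  rw [← ENNReal.ofReal_add h0 (sub_nonneg.2 h1)]
  simp

/-! ### The learn-then-test algorithm

The algorithm runs one and the same three-step stage twice: on the nodes (observables `X_v`) and on
the edges (observables `X_u X_v`). A stage is given `±1`-valued observables `obs i`, `i ∈ ι`, of the
unknown distribution, and their means `mean i` under the reference model. -/

/-- The numbers of samples and repetitions and the accuracy parameters of a stage. -/
structure StageParams where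
  /-- number of samples of the localization step -/
  locSamples : ℕ
  /-- accuracy of the localization step -/
  locTol : ℝ
  /-- number of sign vectors that are learnt -/
  rounds : ℕ
  /-- number of samples from which each sign vector is learnt -/
  learnSamples : ℕ
  /-- number of repetitions of the test of a sign vector -/
  reps : ℕ
  /-- number of samples of each repetition -/
  testSamples : ℕ
  /-- threshold of the test of a sign vector -/
  testThreshold : ℝ

namespace StageParams

/-- The index set of the samples that a stage draws from the unknown distribution: for localization,
for the learning of each of the sign vectors, and for the repetitions of the test. -/
abbrev SampleIdx (s : StageParams) : Type :=
  Fin s.locSamples ⊕ (Fin s.rounds × Fin s.learnSamples) ⊕ (Fin s.reps × Fin s.testSamples)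

/-- The internal randomness of a stage: for every sample used for learning and every observable a
simulated spin of the reference model and a fair coin; and for every sign vector and every
observable a fair coin. -/
abbrev Seed (s : StageParams) (ι : Type) : Type :=
  (((Fin s.rounds × Fin s.learnSamples) × ι → Bool) ×
    ((Fin s.rounds × Fin s.learnSamples) × ι → Bool)) × (Fin s.rounds × ι → Bool)

/-- The law of the internal randomness: everything is independent, the simulated spins have the
means `mean i`, and the coins are fair. -/
def seedLaw (s : StageParams) {ι : Type} [Fintype ι] (mean : ι → ℝ) : Measure (s.Seed ι) :=
  ((Measure.pi fun a : (Fin s.rounds × Fin s.learnSamples) × ι =>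
      rademacher (1 / 2 + mean a.2 / 2)).prod
    (Measure.pi fun _ => rademacher (1 / 2))).prod (Measure.pi fun _ => rademacher (1 / 2))

variable {ι Ω : Type}

/-- Localization: the empirical mean of some observable deviates from its reference mean by at least
the accuracy parameter. -/
def Localizes (s : StageParams) (obs : ι → Ω → ℝ) (mean : ι → ℝ) (x : s.SampleIdx → Ω) : Prop :=
  ∃ i, s.locTol ≤ |(∑ j, obs i (x (Sum.inl j))) / s.locSamples - mean i|

/-- The recentred spin: `(X - Y) / 2` if the observed spin `X` and the simulated spin `Y` differ,
and a fair coin otherwise. -/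
def recentre (X : ℝ) (Y coin : Bool) : ℝ := if X = spin Y then spin coin else (X - spin Y) / 2

/-- Weak learning: in round `l`, the sign of the sum of the recentred spins of each observable, and a
fair coin if this sum vanishes. -/
def learntSign (s : StageParams) (obs : ι → Ω → ℝ) (x : s.SampleIdx → Ω) (r : s.Seed ι)
    (l : Fin s.rounds) (i : ι) : ℝ :=
  let S := ∑ j, recentre (obs i (x (Sum.inr (Sum.inl (l, j))))) (r.1.1 ((l, j), i)) (r.1.2 ((l, j), i))
  if 0 < S then 1 else if S < 0 then -1 else spin (r.2 (l, i))

/-- The statistic of the `t`-th repetition of the test of the sign vector `Γ`: the empirical mean of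
`∑_i Γ_i (obs_i - mean_i)`. -/
def testStatistic [Fintype ι] (s : StageParams) (obs : ι → Ω → ℝ) (mean : ι → ℝ)
    (x : s.SampleIdx → Ω) (Γ : ι → ℝ) (t : Fin s.reps) : ℝ :=
  (∑ j, ∑ i, Γ i * (obs i (x (Sum.inr (Sum.inr (t, j)))) - mean i)) / s.testSamples

open Classical in
/-- The test of the sign vector `Γ` rejects: in the majority of the repetitions the statistic exceeds
the threshold. -/
def TestRejects [Fintype ι] (s : StageParams) (obs : ι → Ω → ℝ) (mean : ι → ℝ)
    (x : s.SampleIdx → Ω) (Γ : ι → ℝ) : Prop :=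
  s.reps < 2 * (Finset.univ.filter fun t : Fin s.reps =>
    s.testThreshold < s.testStatistic obs mean x Γ t).card

/-- The stage rejects: localization finds a deviating observable, or the test rejects for one of the
learnt sign vectors. The same samples serve for the tests of all sign vectors. -/
def Rejects [Fintype ι] (s : StageParams) (obs : ι → Ω → ℝ) (mean : ι → ℝ)
    (x : s.SampleIdx → Ω) (r : s.Seed ι) : Prop :=
  s.Localizes obs mean x ∨ ∃ l, s.TestRejects obs mean x (s.learntSign obs x r l)

end StageParams

/-- The parameters of the learn-then-test algorithm: those of its node stage and of its edge
stage. -/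
structure LTTParams where
  /-- parameters of the node stage -/
  node : StageParams
  /-- parameters of the edge stage -/
  edge : StageParams

/-- The two possible outputs of an identity tester: `p = q`, and `d_SKL(p, q) ≥ ε`. -/
inductive Verdict
  | same
  | far

namespace LTTParams

/-- The index set of all samples that the algorithm draws from the unknown distribution. -/
abbrev SampleIdx (a : LTTParams) : Type := a.node.SampleIdx ⊕ a.edge.SampleIdx

/-- The number of samples that the algorithm draws from the unknown distribution. -/
def sampleCount (a : LTTParams) : ℕ := Fintype.card a.SampleIdx

/-- The internal randomness of the algorithm. -/
abbrev Seed (a : LTTParams) (n : ℕ) : Type := a.node.Seed (Fin n) × a.edge.Seed (Edge n)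

open Classical in
/-- The output of the learn-then-test algorithm for identity testing under external fields, for a
reference model with node marginals `μ` and edge marginals `ν`, on the samples `ω.1` and the
internal randomness `ω.2`. -/
def output (a : LTTParams) {n : ℕ} (μ : Fin n → ℝ) (ν : Edge n → ℝ)
    (ω : (a.SampleIdx → Config n) × a.Seed n) : Verdict :=
  if a.node.Rejects nodeObs μ (fun k => ω.1 (Sum.inl k)) ω.2.1 then Verdict.far
  else if a.edge.Rejects edgeObs ν (fun k => ω.1 (Sum.inr k)) ω.2.2 then Verdict.far
  else Verdict.same

/-- The joint law of i.i.d. samples from `p` and of the independent internal randomness. -/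
def runLaw (a : LTTParams) {n : ℕ} (p q : IsingModel n) :
    Measure ((a.SampleIdx → Config n) × a.Seed n) :=
  (Measure.pi fun _ => p.law).prod
    ((a.node.seedLaw q.nodeMean).prod (a.edge.seedLaw q.edgeMean))

/-- The probability that the algorithm outputs `v`, if it is given the reference model `q` and
samples from `p`. -/
def outputProb (a : LTTParams) {n : ℕ} (p q : IsingModel n) (v : Verdict) : ℝ :=
  (a.runLaw p q).real {ω | a.output q.nodeMean q.edgeMean ω = v}

end LTTParams

end IsingTest

end

/-!
Write `d_i = E_p[g_i] - m_i` for the biases of the observables of a stage and `D = ∑ |d_i|`.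

**Reduction to marginals.** The log-partition functions cancel in the symmetrized divergence, which
is therefore the inner product of the differences of the parameters and of the marginals
(`IsingModel.dSKL_law`). If it is at least `ε`, then `D ≥ ε / (4h)` for the nodes or
`D ≥ ε / (4β)` for the edges. So it is enough to analyse one stage which has to detect `D ≥ 1 / ρ`
among at most `N` observables, with `N = n` or `N = n²`.

**Variance.** Under Dobrushin's condition a step of the heat-bath dynamics contracts the vector of
oscillations of an observable by `1 - η / n` in `ℓ²`, because the matrix of influences
`tanh |θ_{uv}|` is symmetric, and it costs at most `∑ δ_v² / (2n)` of variance. Summing the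
geometric series bounds the variance by `∑ δ_v² / (2η)` (`wVar_le_of_dobrushin`). External fields
only shift the argument of `tanh` in the conditional laws and do not matter
(`IsingModel.variance_le`). For linear combinations of the observables of a stage this gives
`Var (∑ a_i g_i) ≤ (4 / η) (N / n) ∑ a_i²`.

**Weak learning.** The recentred spins are i.i.d. spins of mean `d_i / 2`, and the sign of the sum of
`k` of them has a mean of order `√k d_i` as long as `|d_i| ≤ 1 / √k` (`mul_signMean_ge`); larger
biases are found by localization. Hence the correlation `T = ∑ Γ_i d_i` of a learnt sign vector has a
mean of order at least `√k ∑ d_i² ≥ √k D² / N`. Since `T ≤ D`, it is of this order with probability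
at least of order `√k D / N` (`round_success_of_advantage`). With `k ≈ N² ρ² n^{-2/3}` this
probability is of order `n^{-1/3}`, and `n^{1/3}` rounds suffice. If this `k` is smaller than a
constant, one sample per round is drawn instead, and then the variance bound shows that `T`
concentrates, so that a constant number of rounds suffices (`round_success_of_variance`).

**Testing.** The test statistic of a sign vector has mean `T` and variance at most
`(4 / η) N² / n` per sample, so that batches of about `N⁴ ρ⁴ / (n k) ≤ N² ρ² n^{-1/3}` samples
resolve the threshold by Chebyshev's inequality; a logarithmic number of batches makes the majority
vote reliable for all learnt sign vectors at once (`half_of_trials_le`). The test samples are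
independent of the learning samples, so that the learnt sign vectors may be regarded as fixed. A
stage thus uses `N² ρ² n^{-1/3}` samples up to a constant, a logarithm and an additive term, which is
the claimed `n^{5/3} h² / ε²` for the nodes and `n^{11/3} β² / ε²` for the edges
(`exists_stageParams`).
-/

noncomputable section

namespace IsingTest

open ProbabilityTheory StageParams

/-! ### Heat-bath dynamics and the Poincaré inequality under Dobrushin's condition -/

section Glauber
variable {n : ℕ}

/-- The configuration `x` with the spin of `v` reversed. -/
def flip (v : Fin n) (x : Config n) : Config n := Function.update x v (!x v)

theorem flip_apply_self (v : Fin n) (x : Config n) : flip v x v = !x v := by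
  simp [flip]

theorem flip_apply_of_ne {u v : Fin n} (h : u ≠ v) (x : Config n) : flip v x u = x u := by
  simp [flip, h]

@[simp] theorem flip_flip (v : Fin n) (x : Config n) : flip v (flip v x) = x := by
  funext u
  by_cases h : u = v
  · subst h; simp [flip_apply_self]
  · simp [flip_apply_of_ne h]

theorem flip_comm (u v : Fin n) (x : Config n) : flip u (flip v x) = flip v (flip u x) := by
  by_cases h : u = v
  · rw [h]
  funext w
  by_cases hu : w = u
  · subst hu; simp [flip_apply_self, flip_apply_of_ne h]
  · by_cases hv : w = v
    · subst hv; simp [flip_apply_self, flip_apply_of_ne hu]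
    · simp [flip_apply_of_ne hu, flip_apply_of_ne hv]

/-- Reversing one spin is a bijection of the configurations. -/
theorem sum_flip (v : Fin n) (F : Config n → ℝ) : ∑ x, F (flip v x) = ∑ x, F x :=
  Equiv.sum_comp (Function.Involutive.toPerm (flip v) (flip_flip v)) F

theorem sum_eq_half_sum_add_flip (v : Fin n) (F : Config n → ℝ) :
    ∑ x, F x = (∑ x, (F x + F (flip v x))) / 2 := by
  rw [Finset.sum_add_distrib, sum_flip]; ring

/-- `δ v` bounds the change of `f` under a reversal of the spin of `v`. -/
def OscBound (f : Config n → ℝ) (δ : Fin n → ℝ) : Prop := ∀ v x, |f x - f (flip v x)| ≤ δ v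

theorem OscBound.nonneg {f : Config n → ℝ} {δ : Fin n → ℝ} (h : OscBound f δ) (v : Fin n) :
    0 ≤ δ v := (abs_nonneg _).trans (h v fun _ => true)

theorem OscBound.abs_sub_le {f : Config n → ℝ} {δ : Fin n → ℝ} (h : OscBound f δ)
    (x y : Config n) : |f x - f y| ≤ ∑ v, δ v := by
  have key : ∀ (S : Finset (Fin n)) (x y : Config n), (∀ v, v ∉ S → x v = y v) →
      |f x - f y| ≤ ∑ v ∈ S, δ v := by
    intro S
    induction S using Finset.induction_on with
    | empty =>
      intro x y hxy
      have : x = y := funext fun v => hxy v (by simp)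
      simp [this]
    | insert a S ha ih =>
      intro x y hxy
      rw [Finset.sum_insert ha]
      by_cases hx : x a = y a
      · have := ih x y (fun v hv => by
          by_cases hva : v = a
          · rw [hva, hx]
          · exact hxy v (by simp [hva, hv]))
        linarith [h.nonneg a]
      · have h1 := ih (flip a x) y (fun v hv => by
          by_cases hva : v = a
          · subst hva
            rw [flip_apply_self]
            cases hb : x v <;> cases hc : y v <;> simp_all
          · rw [flip_apply_of_ne hva]
            exact hxy v (by simp [hva, hv]))
        calc |f x - f y| ≤ |f x - f (flip a x)| + |f (flip a x) - f y| := _root_.abs_sub_le _ _ _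
          _ ≤ _ := add_le_add (h a x) h1
  exact key Finset.univ x y (by simp)

/-- The variance of `f` under the weights `w`. -/
def wVar (w f : Config n → ℝ) : ℝ := ∑ x, w x * f x ^ 2 - (∑ x, w x * f x) ^ 2

theorem wVar_le_sum_sub_sq {w : Config n → ℝ} (hw1 : ∑ x, w x = 1) (f : Config n → ℝ) (c : ℝ) :
    wVar w f ≤ ∑ x, w x * (f x - c) ^ 2 := by
  have : ∑ x, w x * (f x - c) ^ 2
      = ∑ x, w x * f x ^ 2 - 2 * c * ∑ x, w x * f x + c ^ 2 * ∑ x, w x := by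
    simp only [Finset.mul_sum]
    rw [← Finset.sum_sub_distrib, ← Finset.sum_add_distrib]
    exact Finset.sum_congr rfl fun x _ => by ring
  rw [this, hw1, wVar]
  nlinarith [sq_nonneg (∑ x, w x * f x - c)]

/-- The probability that heat-bath resampling at `v` reverses the spin of `v`. -/
def flipProb (w : Config n → ℝ) (v : Fin n) (x : Config n) : ℝ :=
  w (flip v x) / (w x + w (flip v x))

/-- The conditional expectation of `f` given all spins but that of `v`. -/
def resample (w : Config n → ℝ) (v : Fin n) (f : Config n → ℝ) (x : Config n) : ℝ :=
  f x - flipProb w v x * (f x - f (flip v x))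

/-- One step of the heat-bath (Glauber) dynamics, as an operator on observables. -/
def glauber (w f : Config n → ℝ) (x : Config n) : ℝ := (∑ v, resample w v f x) / n

theorem flipProb_nonneg {w : Config n → ℝ} (hw : ∀ x, 0 < w x) (v : Fin n) (x : Config n) :
    0 ≤ flipProb w v x := div_nonneg (hw _).le (add_pos (hw _) (hw _)).le

theorem flipProb_le_one {w : Config n → ℝ} (hw : ∀ x, 0 < w x) (v : Fin n) (x : Config n) :
    flipProb w v x ≤ 1 :=
  div_le_one_of_le₀ (by linarith [hw x]) (add_pos (hw _) (hw _)).le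

theorem weight_mul_flipProb {w : Config n → ℝ} (v : Fin n) (x : Config n) :
    w (flip v x) * flipProb w v (flip v x) = w x * flipProb w v x := by
  simp only [flipProb, flip_flip]
  rw [add_comm (w (flip v x)) (w x)]
  ring

theorem sum_resample (w : Config n → ℝ) (v : Fin n) (f : Config n → ℝ) :
    ∑ x, w x * resample w v f x = ∑ x, w x * f x := by
  have h0 : ∑ x, w x * flipProb w v x * (f x - f (flip v x)) = 0 := by
    rw [sum_eq_half_sum_add_flip v]
    have : ∀ x, w x * flipProb w v x * (f x - f (flip v x))
      + w (flip v x) * flipProb w v (flip v x) * (f (flip v x) - f (flip v (flip v x))) = 0 := by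
      intro x
      rw [weight_mul_flipProb, flip_flip]; ring
    rw [Finset.sum_eq_zero fun x _ => this x, zero_div]
  have : ∀ x, w x * resample w v f x
      = w x * f x - w x * flipProb w v x * (f x - f (flip v x)) := by
    intro x; rw [resample]; ring
  simp only [this, Finset.sum_sub_distrib, h0, sub_zero]

/-- The Dirichlet form of the resampling at one node is controlled by the oscillation there. -/
theorem sum_mul_sub_resample_le {w : Config n → ℝ} (hw : ∀ x, 0 < w x) (hw1 : ∑ x, w x = 1)
    {f : Config n → ℝ} {δ : Fin n → ℝ} (h : OscBound f δ) (v : Fin n) :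
    ∑ x, w x * (f x * (f x - resample w v f x)) ≤ δ v ^ 2 / 4 := by
  rw [sum_eq_half_sum_add_flip v]
  have h1 : ∀ x, w x * (f x * (f x - resample w v f x))
      + w (flip v x) * (f (flip v x) * (f (flip v x) - resample w v f (flip v x)))
      ≤ (w x + w (flip v x)) / 4 * δ v ^ 2 := by
    intro x
    have e1 : w x * (f x * (f x - resample w v f x))
        + w (flip v x) * (f (flip v x) * (f (flip v x) - resample w v f (flip v x)))
        = w x * flipProb w v x * (f x - f (flip v x)) ^ 2 := by
      have := weight_mul_flipProb (w := w) v x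
      simp only [resample, flip_flip]
      linear_combination (f (flip v x) * (f (flip v x) - f x)) * this
    rw [e1]
    have h2 : w x * flipProb w v x ≤ (w x + w (flip v x)) / 4 := by
      have hs : 0 < w x + w (flip v x) := add_pos (hw _) (hw _)
      rw [flipProb, ← mul_div_assoc, div_le_iff₀ hs]
      nlinarith [sq_nonneg (w x - w (flip v x))]
    have h3 : (f x - f (flip v x)) ^ 2 ≤ δ v ^ 2 := sq_le_sq' (by linarith [abs_le.1 (h v x)])
      (abs_le.1 (h v x)).2
    have : 0 ≤ w x * flipProb w v x := mul_nonneg (hw x).le (flipProb_nonneg hw v x)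
    exact mul_le_mul h2 h3 (sq_nonneg _) (by linarith [hw x, hw (flip v x)])
  have h4 := Finset.sum_le_sum fun x (_ : x ∈ Finset.univ) => h1 x
  have h5 : ∑ x, (w x + w (flip v x)) / 4 * δ v ^ 2 = δ v ^ 2 / 2 := by
    rw [← Finset.sum_mul, ← Finset.sum_div, Finset.sum_add_distrib, sum_flip, hw1]; ring
  linarith

/-- A step of the dynamics lowers the variance by at most twice the Dirichlet form. -/
theorem wVar_le_wVar_glauber_add {w : Config n → ℝ} (hw : ∀ x, 0 < w x) (hw1 : ∑ x, w x = 1)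
    (hn : 0 < n) {f : Config n → ℝ} {δ : Fin n → ℝ} (h : OscBound f δ) :
    wVar w f ≤ wVar w (glauber w f) + (∑ v, δ v ^ 2) / (2 * n) := by
  have hn' : (0 : ℝ) < n := by exact_mod_cast hn
  have hmean : ∑ x, w x * glauber w f x = ∑ x, w x * f x := by
    simp only [glauber, mul_div_assoc', Finset.mul_sum, ← Finset.sum_div]
    rw [Finset.sum_comm]
    simp only [sum_resample]
    simp [hn'.ne']
  have hdir : ∑ x, w x * (f x * (f x - glauber w f x)) ≤ (∑ v, δ v ^ 2) / (4 * n) := by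
    have e : ∀ x, w x * (f x * (f x - glauber w f x))
        = (∑ v, w x * (f x * (f x - resample w v f x))) / n := by
      intro x
      rw [glauber, ← Finset.mul_sum, ← Finset.mul_sum, Finset.sum_sub_distrib]
      simp
      field_simp
    simp only [e, ← Finset.sum_div]
    rw [Finset.sum_comm, div_le_div_iff₀ hn' (by positivity)]
    have := Finset.sum_le_sum fun v (_ : v ∈ Finset.univ) => sum_mul_sub_resample_le hw hw1 h v
    rw [← Finset.sum_div] at this
    nlinarith
  have hsq : 0 ≤ ∑ x, w x * (f x - glauber w f x) ^ 2 :=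
    Finset.sum_nonneg fun x _ => mul_nonneg (hw x).le (sq_nonneg _)
  have hexp : ∑ x, w x * (f x - glauber w f x) ^ 2
      = 2 * ∑ x, w x * (f x * (f x - glauber w f x)) - ∑ x, w x * f x ^ 2
        + ∑ x, w x * glauber w f x ^ 2 := by
    rw [Finset.mul_sum, ← Finset.sum_sub_distrib, ← Finset.sum_add_distrib]
    exact Finset.sum_congr rfl fun x _ => by ring
  rw [wVar, wVar, hmean]
  have : (∑ v, δ v ^ 2) / (2 * n) = 2 * ((∑ v, δ v ^ 2) / (4 * n)) := by field_simp; norm_num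
  rw [this]
  linarith

/-- Resampling at `v` spreads the oscillation at `v` to the other nodes `u` with the factor `c u v`
that bounds the influence of `u` on the conditional law at `v`. -/
theorem abs_resample_sub_le {w : Config n → ℝ} (hw : ∀ x, 0 < w x) {c : Fin n → Fin n → ℝ}
    (hc : ∀ u v, u ≠ v → ∀ x, |flipProb w v x - flipProb w v (flip u x)| ≤ c u v)
    {f : Config n → ℝ} {δ : Fin n → ℝ} (h : OscBound f δ) {u v : Fin n} (huv : u ≠ v)
    (x : Config n) :
    |resample w v f x - resample w v f (flip u x)| ≤ δ u + c u v * δ v := by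
  have e : resample w v f x - resample w v f (flip u x)
      = (1 - flipProb w v x) * (f x - f (flip u x))
        + flipProb w v x * (f (flip v x) - f (flip u (flip v x)))
        - (flipProb w v x - flipProb w v (flip u x)) * (f (flip u x) - f (flip v (flip u x))) := by
    simp only [resample, flip_comm u v]
    ring
  rw [e]
  have r0 := flipProb_nonneg hw v x
  have r1 := flipProb_le_one hw v x
  have a1 : |(1 - flipProb w v x) * (f x - f (flip u x))| ≤ (1 - flipProb w v x) * δ u := by
    rw [abs_mul, abs_of_nonneg (by linarith)]
    exact mul_le_mul_of_nonneg_left (h u x) (by linarith)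
  have a2 : |flipProb w v x * (f (flip v x) - f (flip u (flip v x)))| ≤ flipProb w v x * δ u := by
    rw [abs_mul, abs_of_nonneg r0]
    exact mul_le_mul_of_nonneg_left (h u _) r0
  have a3 : |(flipProb w v x - flipProb w v (flip u x)) * (f (flip u x) - f (flip v (flip u x)))|
      ≤ c u v * δ v := by
    rw [abs_mul]
    exact mul_le_mul (hc u v huv x) (h v _) (abs_nonneg _) ((abs_nonneg _).trans (hc u v huv x))
  refine (abs_sub _ _).trans ((add_le_add (abs_add_le _ _) le_rfl).trans ?_)
  linarith

theorem resample_flip (w : Config n → ℝ) (hw : ∀ x, 0 < w x) (v : Fin n) (f : Config n → ℝ)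
    (x : Config n) : resample w v f (flip v x) = resample w v f x := by
  have hs : w x + w (flip v x) ≠ 0 := (add_pos (hw _) (hw _)).ne'
  have hs' : w (flip v x) + w x ≠ 0 := by rwa [add_comm]
  simp only [resample, flipProb, flip_flip]
  field_simp
  ring

/-- A symmetric nonnegative matrix with row sums at most `r` has `ℓ²`-operator norm at most `r`. -/
theorem sum_sq_mulVec_le {M : Fin n → Fin n → ℝ} {r : ℝ} (hM : ∀ u v, 0 ≤ M u v)
    (hsym : ∀ u v, M u v = M v u) (hr : ∀ u, ∑ v, M u v ≤ r) (hr0 : 0 ≤ r) (δ : Fin n → ℝ) :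
    ∑ u, (∑ v, M u v * δ v) ^ 2 ≤ r ^ 2 * ∑ v, δ v ^ 2 := by
  have h1 : ∀ u, (∑ v, M u v * δ v) ^ 2 ≤ r * ∑ v, M u v * δ v ^ 2 := by
    intro u
    refine (Finset.sum_sq_le_sum_mul_sum_of_sq_le_mul Finset.univ (f := fun v => M u v)
      (g := fun v => M u v * δ v ^ 2) (fun v _ => hM u v)
      (fun v _ => mul_nonneg (hM u v) (sq_nonneg _)) (fun v _ => le_of_eq (by ring))).trans ?_
    exact mul_le_mul_of_nonneg_right (hr u)
      (Finset.sum_nonneg fun v _ => mul_nonneg (hM u v) (sq_nonneg _))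
  refine (Finset.sum_le_sum fun u _ => h1 u).trans ?_
  rw [← Finset.mul_sum, Finset.sum_comm, sq, mul_assoc]
  refine mul_le_mul_of_nonneg_left ?_ hr0
  rw [Finset.mul_sum]
  refine Finset.sum_le_sum fun v _ => ?_
  rw [← Finset.sum_mul]
  refine mul_le_mul_of_nonneg_right ?_ (sq_nonneg _)
  simpa only [hsym _ v] using hr v

/-- **Poincaré inequality under Dobrushin's condition.** If the influences `c` are symmetric with
row sums at most `1 - η`, then the variance is at most `1 / (2η)` times the sum of the squared
oscillations: the Glauber dynamics contracts the vector of oscillations by `1 - η / n` in `ℓ²`. -/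
theorem wVar_le_of_dobrushin {w : Config n → ℝ} (hw : ∀ x, 0 < w x) (hw1 : ∑ x, w x = 1)
    (hn : 0 < n) {c : Fin n → Fin n → ℝ} {η : ℝ} (hη : 0 < η)
    (hc : ∀ u v, u ≠ v → ∀ x, |flipProb w v x - flipProb w v (flip u x)| ≤ c u v)
    (hc0 : ∀ u v, 0 ≤ c u v) (hsym : ∀ u v, c u v = c v u)
    (hrow : ∀ u, ∑ v, c u v ≤ 1 - η) {f : Config n → ℝ} {δ : Fin n → ℝ} (h : OscBound f δ) :
    wVar w f ≤ (∑ v, δ v ^ 2) / (2 * η) := by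
  have hn' : (0 : ℝ) < n := by exact_mod_cast hn
  have hn1 : (1 : ℝ) ≤ n := by exact_mod_cast hn
  have hη1 : η ≤ 1 := by
    have := (Finset.sum_nonneg fun v _ => hc0 ⟨0, hn⟩ v).trans (hrow ⟨0, hn⟩)
    linarith
  set r : ℝ := 1 - η / n with hr
  have hηn : η / n ≤ 1 := by rw [div_le_one hn']; linarith
  have hηn0 : 0 < η / n := by positivity
  have hr0 : 0 ≤ r := by linarith
  have hr1 : r < 1 := by linarith
  set M : Fin n → Fin n → ℝ := fun u v => ((if u = v then (n : ℝ) - 1 else 0) + c u v) / n with hM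
  have hM0 : ∀ u v, 0 ≤ M u v := by
    intro u v
    refine div_nonneg (add_nonneg ?_ (hc0 u v)) hn'.le
    split_ifs <;> linarith
  have hMsym : ∀ u v, M u v = M v u := by
    intro u v
    simp only [hM, hsym u v, eq_comm (a := u)]
  have hMrow : ∀ u, ∑ v, M u v ≤ r := by
    intro u
    simp only [hM, ← Finset.sum_div, Finset.sum_add_distrib, Finset.sum_ite_eq, Finset.mem_univ,
      if_true]
    rw [div_le_iff₀ hn', hr, sub_mul, div_mul_cancel₀ _ hn'.ne']
    linarith [hrow u]
  have hstep : ∀ (f : Config n → ℝ) (δ : Fin n → ℝ), OscBound f δ →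
      OscBound (glauber w f) fun u => ∑ v, M u v * δ v := by
    intro f δ h u x
    have e : glauber w f x - glauber w f (flip u x)
        = (∑ v, (resample w v f x - resample w v f (flip u x))) / n := by
      simp only [glauber, Finset.sum_sub_distrib, sub_div]
    have hb : ∀ v, |resample w v f x - resample w v f (flip u x)|
        ≤ (if u = v then 0 else δ u) + c u v * δ v := by
      intro v
      split_ifs with huv
      · subst huv
        rw [resample_flip w hw, sub_self, abs_zero, zero_add]
        exact mul_nonneg (hc0 _ _) (h.nonneg u)
      · exact abs_resample_sub_le hw hc h huv x
    rw [e, abs_div, abs_of_pos hn', div_le_iff₀ hn']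
    refine (Finset.abs_sum_le_sum_abs _ _).trans ((Finset.sum_le_sum fun v _ => hb v).trans
      (le_of_eq ?_))
    have e2 : ∀ v, M u v * δ v = ((if u = v then ((n : ℝ) - 1) * δ v else 0) + c u v * δ v) / n := by
      intro v; simp only [hM]; split_ifs <;> ring
    have e3 : ∀ v, (if u = v then (0 : ℝ) else δ u) = δ u - if u = v then δ u else 0 := by
      intro v; split_ifs <;> ring
    simp only [e2, e3, ← Finset.sum_div, Finset.sum_add_distrib, Finset.sum_sub_distrib,
      Finset.sum_ite_eq, Finset.mem_univ, if_true, Finset.sum_const, Finset.card_univ,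
      Fintype.card_fin, nsmul_eq_mul]
    field_simp
  have hind : ∀ (t : ℕ) (f : Config n → ℝ) (δ : Fin n → ℝ), OscBound f δ →
      wVar w f ≤ (1 / (2 * η) + n * (r ^ 2) ^ t) * ∑ v, δ v ^ 2 := by
    intro t
    induction t with
    | zero =>
      intro f δ h
      have hS : 0 ≤ ∑ v, δ v ^ 2 := Finset.sum_nonneg fun _ _ => sq_nonneg _
      have h1 : wVar w f ≤ (∑ v, δ v) ^ 2 := by
        refine (wVar_le_sum_sub_sq hw1 f (f fun _ => true)).trans ?_
        have : ∀ x, w x * (f x - f fun _ => true) ^ 2 ≤ w x * (∑ v, δ v) ^ 2 := fun x =>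
          mul_le_mul_of_nonneg_left (sq_le_sq' (by linarith [abs_le.1 (h.abs_sub_le x fun _ => true)])
            (abs_le.1 (h.abs_sub_le x fun _ => true)).2) (hw x).le
        refine (Finset.sum_le_sum fun x _ => this x).trans ?_
        rw [← Finset.sum_mul, hw1, one_mul]
      have h2 : (∑ v, δ v) ^ 2 ≤ n * ∑ v, δ v ^ 2 := by
        simpa using sq_sum_le_card_mul_sum_sq (s := (Finset.univ : Finset (Fin n))) (f := δ)
      have h3 : 0 ≤ 1 / (2 * η) * ∑ v, δ v ^ 2 := by positivity
      rw [pow_zero, mul_one, add_mul]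
      linarith
    | succ t ih =>
      intro f δ h
      have h1 := wVar_le_wVar_glauber_add hw hw1 hn h
      have h2 := ih _ _ (hstep f δ h)
      have h3 := sum_sq_mulVec_le hM0 hMsym hMrow hr0 δ
      have hS : 0 ≤ ∑ v, δ v ^ 2 := Finset.sum_nonneg fun _ _ => sq_nonneg _
      have hA : 0 ≤ 1 / (2 * η) + n * (r ^ 2) ^ t := by positivity
      have h4 := h2.trans (mul_le_mul_of_nonneg_left h3 hA)
      have h5 : (1 / (2 * η)) * r ^ 2 + 1 / (2 * n) ≤ 1 / (2 * η) := by
        have h6 : r ^ 2 ≤ r := by nlinarith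
        have h7 : (1 / (2 * η)) * r = 1 / (2 * η) - 1 / (2 * n) := by
          rw [hr]; field_simp
        have := mul_le_mul_of_nonneg_left h6 (by positivity : (0 : ℝ) ≤ 1 / (2 * η))
        linarith
      have h8 := mul_le_mul_of_nonneg_right h5 hS
      have h9 : (∑ v, δ v ^ 2) / (2 * n) = 1 / (2 * n) * ∑ v, δ v ^ 2 := by ring
      have h10 : (1 / (2 * η) + n * (r ^ 2) ^ t) * (r ^ 2 * ∑ v, δ v ^ 2)
        = (1 / (2 * η)) * r ^ 2 * (∑ v, δ v ^ 2) + n * (r ^ 2) ^ (t + 1) * ∑ v, δ v ^ 2 := by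
        ring
      rw [add_mul] at h8
      rw [add_mul]
      linarith
  have hlim : Filter.Tendsto (fun t : ℕ => (1 / (2 * η) + n * (r ^ 2) ^ t) * ∑ v, δ v ^ 2)
      Filter.atTop (nhds ((1 / (2 * η) + n * 0) * ∑ v, δ v ^ 2)) :=
    ((tendsto_const_nhds).add ((tendsto_pow_atTop_nhds_zero_of_lt_one (sq_nonneg r)
      (by nlinarith)).const_mul _)).mul_const _
  have := ge_of_tendsto' hlim fun t => hind t f δ h
  refine this.trans (le_of_eq ?_)
  ring

end Glauber

/-! ### Variance bounds for Ising models in the high-temperature regime -/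

theorem abs_spin (b : Bool) : |spin b| = 1 := by cases b <;> simp [spin]

theorem spin_not (b : Bool) : spin (!b) = -spin b := by cases b <;> simp [spin]

theorem abs_nodeObs {n : ℕ} (v : Fin n) (x : Config n) : |nodeObs v x| = 1 := abs_spin _

theorem abs_edgeObs {n : ℕ} (e : Edge n) (x : Config n) : |edgeObs e x| = 1 := by
  rw [edgeObs, abs_mul, abs_spin, abs_spin, one_mul]

/-- `|tanh a - tanh b| ≤ 2 tanh |(a - b) / 2|`: among the intervals of a given length, `tanh` varies
most on the centred one. -/
theorem abs_tanh_sub_tanh_le (s b : ℝ) :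
    |Real.tanh (s + b) - Real.tanh (s - b)| ≤ 2 * Real.tanh |b| := by
  have key : ∀ b : ℝ, 0 ≤ b → |Real.tanh (s + b) - Real.tanh (s - b)| ≤ 2 * Real.tanh b := by
    intro b hb
    have c1 := Real.cosh_pos (s + b)
    have c2 := Real.cosh_pos (s - b)
    have c3 := Real.cosh_pos b
    have hs : 0 ≤ Real.sinh b := Real.sinh_nonneg_iff.2 hb
    have e1 : Real.tanh (s + b) - Real.tanh (s - b)
        = 2 * Real.sinh b * Real.cosh b / (Real.cosh (s + b) * Real.cosh (s - b)) := by
      rw [Real.tanh_eq_sinh_div_cosh, Real.tanh_eq_sinh_div_cosh, div_sub_div _ _ c1.ne' c2.ne']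
      congr 1
      rw [Real.sinh_add, Real.sinh_sub, Real.cosh_add, Real.cosh_sub]
      have := Real.cosh_sq s
      linear_combination (2 * Real.sinh b * Real.cosh b) * this
    have e2 : Real.cosh (s + b) * Real.cosh (s - b) = Real.cosh b ^ 2 + Real.sinh s ^ 2 := by
      rw [Real.cosh_add, Real.cosh_sub]
      have h1 := Real.cosh_sq s
      have h2 := Real.cosh_sq b
      linear_combination (Real.cosh b ^ 2) * h1 + (Real.sinh s ^ 2) * h2
    rw [e1, e2, abs_of_nonneg (by positivity), Real.tanh_eq_sinh_div_cosh, mul_div_assoc',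
      div_le_div_iff₀ (by positivity) c3]
    nlinarith [mul_nonneg hs (sq_nonneg (Real.sinh s))]
  rcases le_total 0 b with hb | hb
  · rw [abs_of_nonneg hb]; exact key b hb
  · rw [abs_of_nonpos hb, abs_sub_comm]
    simpa [sub_eq_add_neg] using key (-b) (by linarith)

theorem inv_one_add_exp_two_mul (a : ℝ) : 1 / (1 + Real.exp (2 * a)) = (1 - Real.tanh a) / 2 := by
  have h := Real.exp_pos a
  have h' := Real.exp_pos (-a)
  have e : Real.exp (2 * a) = Real.exp a / Real.exp (-a) := by
    rw [← Real.exp_sub]; ring_nf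
  rw [Real.tanh_eq_sinh_div_cosh, Real.sinh_eq, Real.cosh_eq, e]
  field_simp
  ring

section Edges
variable {n : ℕ}

/-- The edge `e` joins the nodes `u` and `v`. -/
def Joins (e : Edge n) (u v : Fin n) : Prop :=
  (e.1.1 = u ∧ e.1.2 = v) ∨ (e.1.1 = v ∧ e.1.2 = u)

instance (e : Edge n) (u v : Fin n) : Decidable (Joins e u v) := by
  unfold Joins; infer_instance

theorem joins_comm (e : Edge n) (u v : Fin n) : Joins e u v ↔ Joins e v u := or_comm

theorem exists_edge_joins {u v : Fin n} (h : u ≠ v) :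
    ∃ e : Edge n, Joins e u v ∧ ∀ e', Joins e' u v → e' = e := by
  rcases lt_or_gt_of_ne h with h | h
  · refine ⟨⟨(u, v), h⟩, Or.inl ⟨rfl, rfl⟩, ?_⟩
    rintro ⟨⟨a, b⟩, hab⟩ (⟨h1, h2⟩ | ⟨h1, h2⟩)
    · simp_all
    · simp only at h1 h2 hab; subst h1 h2; exact absurd hab (lt_asymm h)
  · refine ⟨⟨(v, u), h⟩, Or.inr ⟨rfl, rfl⟩, ?_⟩
    rintro ⟨⟨a, b⟩, hab⟩ (⟨h1, h2⟩ | ⟨h1, h2⟩)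
    · simp only at h1 h2 hab; subst h1 h2; exact absurd hab (lt_asymm h)
    · simp_all

theorem not_joins_self (e : Edge n) (u : Fin n) : ¬ Joins e u u := by
  rintro (⟨h1, h2⟩ | ⟨h1, h2⟩) <;> exact absurd (h1.trans h2.symm) e.2.ne

/-- Summing over the edges at `v` is summing over the other endpoint. -/
theorem sum_sum_joins (g : Edge n → ℝ) (v : Fin n) :
    ∑ u, ∑ e ∈ Finset.univ.filter (fun e => Joins e v u), g e
      = ∑ e ∈ Finset.univ.filter (fun e : Edge n => e.1.1 = v ∨ e.1.2 = v), g e := by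
  simp only [Finset.sum_filter]
  rw [Finset.sum_comm]
  refine Finset.sum_congr rfl fun e _ => ?_
  have hne := e.2.ne
  by_cases h1 : e.1.1 = v
  · have : ∀ u, Joins e v u ↔ e.1.2 = u := by
      intro u
      refine ⟨?_, fun h => Or.inl ⟨h1, h⟩⟩
      rintro (⟨_, h⟩ | ⟨_, h⟩)
      · exact h
      · exact absurd (h1.trans h.symm) hne
    simp [this, h1]
  · by_cases h2 : e.1.2 = v
    · have : ∀ u, Joins e v u ↔ e.1.1 = u := by
        intro u
        refine ⟨?_, fun h => Or.inr ⟨h, h2⟩⟩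
        rintro (⟨h, _⟩ | ⟨h, _⟩)
        · exact absurd h h1
        · exact h
      simp [this, h2]
    · have : ∀ u, ¬ Joins e v u := by
        rintro u (⟨h, _⟩ | ⟨_, h⟩)
        · exact h1 h
        · exact h2 h
      simp [this, h1, h2]

theorem sum_sum_endpoint (g : Edge n → ℝ) :
    ∑ u, ∑ e ∈ Finset.univ.filter (fun e : Edge n => e.1.1 = u ∨ e.1.2 = u), g e
      = 2 * ∑ e, g e := by
  simp only [Finset.sum_filter]
  rw [Finset.sum_comm, Finset.mul_sum]
  refine Finset.sum_congr rfl fun e _ => ?_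
  have : ∀ u, (if e.1.1 = u ∨ e.1.2 = u then g e else 0)
      = (if e.1.1 = u then g e else 0) + if e.1.2 = u then g e else 0 := by
    intro u
    have hne := e.2.ne
    by_cases h1 : e.1.1 = u
    · have h2 : e.1.2 ≠ u := fun h => hne (h1.trans h.symm)
      simp [h1, h2]
    · simp [h1]
  simp only [this, Finset.sum_add_distrib, Finset.sum_ite_eq, Finset.mem_univ, if_true]
  ring

theorem card_joins_le_one (u v : Fin n) :
    (Finset.univ.filter (fun e : Edge n => Joins e u v)).card ≤ 1 := by
  by_cases h : u = v
  · subst h; simp [not_joins_self]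
  · obtain ⟨e, _, he⟩ := exists_edge_joins h
    refine Finset.card_le_one.2 fun a ha b hb => ?_
    rw [he a (Finset.mem_filter.1 ha).2, he b (Finset.mem_filter.1 hb).2]

theorem card_endpoint_le (v : Fin n) :
    ((Finset.univ.filter (fun e : Edge n => e.1.1 = v ∨ e.1.2 = v)).card : ℝ) ≤ n := by
  have h := sum_sum_joins (fun _ => (1 : ℝ)) v
  simp only [Finset.sum_const, nsmul_eq_mul, mul_one] at h
  rw [← h]
  calc ∑ u, ((Finset.univ.filter (fun e : Edge n => Joins e v u)).card : ℝ)
      ≤ ∑ _u : Fin n, (1 : ℝ) := Finset.sum_le_sum fun u _ => by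
        exact_mod_cast card_joins_le_one v u
    _ = n := by simp

theorem card_edge_le (n : ℕ) : Fintype.card (Edge n) ≤ n ^ 2 := by
  refine (Fintype.card_subtype_le _).trans (le_of_eq ?_)
  simp [sq]

theorem nodeObs_flip_of_ne {u v : Fin n} (h : u ≠ v) (x : Config n) :
    nodeObs u (flip v x) = nodeObs u x := by
  rw [nodeObs, flip_apply_of_ne h, nodeObs]

theorem nodeObs_flip_self (v : Fin n) (x : Config n) : nodeObs v (flip v x) = -nodeObs v x := by
  rw [nodeObs, flip_apply_self, spin_not, nodeObs]

theorem edgeObs_eq (e : Edge n) (x : Config n) :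
    edgeObs e x = nodeObs e.1.1 x * nodeObs e.1.2 x := rfl

theorem edgeObs_flip_of_not {e : Edge n} {v : Fin n} (h : ¬ (e.1.1 = v ∨ e.1.2 = v))
    (x : Config n) : edgeObs e (flip v x) = edgeObs e x := by
  rw [not_or] at h
  rw [edgeObs_eq, nodeObs_flip_of_ne h.1, nodeObs_flip_of_ne h.2, edgeObs_eq]

/-- A linear combination of spins changes by at most `2 |a v|` if one spin is reversed. -/
theorem oscBound_node (a : Fin n → ℝ) :
    OscBound (fun x => ∑ v, a v * nodeObs v x) fun v => 2 * |a v| := by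
  intro v x
  simp only
  rw [← Finset.sum_sub_distrib, Finset.sum_eq_single v]
  · rw [nodeObs_flip_self, ← mul_sub, sub_neg_eq_add, ← two_mul, abs_mul, abs_mul, abs_nodeObs,
      abs_two]
    linarith
  · intro u _ hu
    rw [nodeObs_flip_of_ne hu, sub_self]
  · simp

theorem oscBound_edge (a : Edge n → ℝ) :
    OscBound (fun x => ∑ e, a e * edgeObs e x)
      fun v => 2 * ∑ e ∈ Finset.univ.filter (fun e : Edge n => e.1.1 = v ∨ e.1.2 = v), |a e| := by
  intro v x
  simp only
  rw [← Finset.sum_sub_distrib, Finset.sum_filter, Finset.mul_sum]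
  refine (Finset.abs_sum_le_sum_abs _ _).trans (Finset.sum_le_sum fun e _ => ?_)
  split_ifs with h
  · rw [← mul_sub, abs_mul]
    have := abs_sub (edgeObs e x) (edgeObs e (flip v x))
    rw [abs_edgeObs, abs_edgeObs] at this
    nlinarith [abs_nonneg (a e)]
  · rw [edgeObs_flip_of_not h]; simp

end Edges

namespace IsingModel
variable {n : ℕ}

/-- The probability of a configuration. -/
def weight (p : IsingModel n) (x : Config n) : ℝ := Real.exp (p.exponent x) / p.partition

theorem weight_pos (p : IsingModel n) (x : Config n) : 0 < p.weight x :=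
  div_pos (Real.exp_pos _) p.partition_pos

theorem sum_weight (p : IsingModel n) : ∑ x, p.weight x = 1 := by
  simp only [weight, ← Finset.sum_div]
  exact div_self p.partition_pos.ne'

theorem integral_law (p : IsingModel n) (f : Config n → ℝ) :
    ∫ x, f x ∂p.law = ∑ x, p.weight x * f x := by
  rw [law, PMF.integral_eq_sum]
  refine Finset.sum_congr rfl fun x _ => ?_
  rw [pmf, PMF.ofFintype_apply, smul_eq_mul]
  change (ENNReal.ofReal (p.weight x)).toReal * f x = _
  rw [ENNReal.toReal_ofReal (p.weight_pos x).le]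

/-- The mixed second difference of the exponent sees only the edge that joins the two nodes. -/
theorem exponent_second_difference (p : IsingModel n) {u v : Fin n} (huv : u ≠ v) (x : Config n) :
    |p.exponent x - p.exponent (flip v x)
        - (p.exponent (flip u x) - p.exponent (flip v (flip u x)))|
      = 4 * |∑ e ∈ Finset.univ.filter (fun e => Joins e u v), p.edge e| := by
  obtain ⟨e, he, huniq⟩ := exists_edge_joins huv
  have hfil : Finset.univ.filter (fun e => Joins e u v) = {e} := by
    ext e'
    simp only [Finset.mem_filter, Finset.mem_univ, true_and, Finset.mem_singleton]
    exact ⟨huniq e', fun h => h ▸ he⟩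
  have hnode : ∑ w, p.node w * nodeObs w x - ∑ w, p.node w * nodeObs w (flip v x)
      - (∑ w, p.node w * nodeObs w (flip u x) - ∑ w, p.node w * nodeObs w (flip v (flip u x)))
      = 0 := by
    rw [← Finset.sum_sub_distrib, ← Finset.sum_sub_distrib, ← Finset.sum_sub_distrib]
    refine Finset.sum_eq_zero fun w _ => ?_
    by_cases hw : w = v
    · subst hw
      rw [nodeObs_flip_self, nodeObs_flip_self, nodeObs_flip_of_ne huv.symm]; ring
    · rw [nodeObs_flip_of_ne hw, nodeObs_flip_of_ne hw]; ring
  have hedge : ∑ w, p.edge w * edgeObs w x - ∑ w, p.edge w * edgeObs w (flip v x)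
      - (∑ w, p.edge w * edgeObs w (flip u x) - ∑ w, p.edge w * edgeObs w (flip v (flip u x)))
      = 4 * p.edge e * edgeObs e x := by
    rw [← Finset.sum_sub_distrib, ← Finset.sum_sub_distrib, ← Finset.sum_sub_distrib,
      Finset.sum_eq_single e]
    · rcases he with ⟨h1, h2⟩ | ⟨h1, h2⟩ <;>
      · simp only [edgeObs_eq, h1, h2, nodeObs_flip_self, nodeObs_flip_of_ne huv,
          nodeObs_flip_of_ne huv.symm]
        ring
    · intro e' _ hne
      have hj : ¬ Joins e' u v := fun h => hne (huniq e' h)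
      by_cases h1 : e'.1.1 = v ∨ e'.1.2 = v
      · have h2 : ¬ (e'.1.1 = u ∨ e'.1.2 = u) := by
          intro h2
          apply hj
          rcases h1 with h1 | h1 <;> rcases h2 with h2 | h2
          · exact absurd (h2.symm.trans h1) huv
          · exact Or.inr ⟨h1, h2⟩
          · exact Or.inl ⟨h2, h1⟩
          · exact absurd (h2.symm.trans h1) huv
        rw [flip_comm v u, edgeObs_flip_of_not h2, edgeObs_flip_of_not h2]; ring
      · rw [edgeObs_flip_of_not h1, edgeObs_flip_of_not h1]; ring
    · simp
  rw [hfil, Finset.sum_singleton]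
  have : p.exponent x - p.exponent (flip v x)
        - (p.exponent (flip u x) - p.exponent (flip v (flip u x))) = 4 * p.edge e * edgeObs e x := by
    simp only [exponent]; linarith
  rw [this, abs_mul, abs_edgeObs, abs_mul, mul_one]
  norm_num

theorem flipProb_weight (p : IsingModel n) (v : Fin n) (x : Config n) :
    flipProb p.weight v x
      = (1 - Real.tanh ((p.exponent x - p.exponent (flip v x)) / 2)) / 2 := by
  rw [← inv_one_add_exp_two_mul, mul_div_cancel₀ _ two_ne_zero, Real.exp_sub, flipProb, weight,
    weight]
  have := p.partition_pos
  have h1 := Real.exp_pos (p.exponent x)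
  have h2 := Real.exp_pos (p.exponent (flip v x))
  field_simp
  ring

theorem abs_flipProb_sub_le (p : IsingModel n) {u v : Fin n} (huv : u ≠ v) (x : Config n) :
    |flipProb p.weight v x - flipProb p.weight v (flip u x)|
      ≤ Real.tanh |∑ e ∈ Finset.univ.filter (fun e => Joins e u v), p.edge e| := by
  have h := p.exponent_second_difference huv x
  rw [flipProb_weight, flipProb_weight]
  set A := (p.exponent x - p.exponent (flip v x)) / 2 with hA
  set B := (p.exponent (flip u x) - p.exponent (flip v (flip u x))) / 2 with hB
  have hAB : |(B - A) / 2| = |∑ e ∈ Finset.univ.filter (fun e => Joins e u v), p.edge e| := by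
    have : p.exponent x - p.exponent (flip v x)
        - (p.exponent (flip u x) - p.exponent (flip v (flip u x))) = -4 * ((B - A) / 2) := by
      rw [hA, hB]; ring
    rw [this, abs_mul, abs_neg, abs_of_pos (by norm_num : (0 : ℝ) < 4)] at h
    linarith
  have key := abs_tanh_sub_tanh_le ((A + B) / 2) ((B - A) / 2)
  rw [hAB] at key
  have e1 : (A + B) / 2 + (B - A) / 2 = B := by ring
  have e2 : (A + B) / 2 - (B - A) / 2 = A := by ring
  rw [e1, e2] at key
  have e3 : (1 - Real.tanh A) / 2 - (1 - Real.tanh B) / 2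
      = (Real.tanh B - Real.tanh A) / 2 := by ring
  rw [e3, abs_div, abs_two]
  linarith

/-- The variance bound for Ising models in the high-temperature regime: external fields enter the
conditional laws only through the argument of `tanh`, so that Dobrushin's condition does not see
them. -/
theorem variance_le (p : IsingModel n) {η : ℝ} (hη : 0 < η) (hp : p.HighTemperature η)
    (hn : 0 < n) {f : Config n → ℝ} {δ : Fin n → ℝ} (h : OscBound f δ) :
    ProbabilityTheory.variance f p.law ≤ (∑ v, δ v ^ 2) / (2 * η) := by
  have hv : ProbabilityTheory.variance f p.law = wVar p.weight f := by
    rw [ProbabilityTheory.variance_eq_sub (MemLp.of_discrete), wVar, integral_law, integral_law]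
    rfl
  rw [hv]
  refine wVar_le_of_dobrushin p.weight_pos p.sum_weight hn hη
    (c := fun u v => Real.tanh |∑ e ∈ Finset.univ.filter (fun e => Joins e u v), p.edge e|)
    (fun u v huv x => p.abs_flipProb_sub_le huv x) (fun u v => ?_) (fun u v => ?_) (fun v => ?_) h
  · rw [Real.tanh_eq_sinh_div_cosh]
    exact div_nonneg (Real.sinh_nonneg_iff.2 (abs_nonneg _)) (Real.cosh_pos _).le
  · simp only [joins_comm _ u v]
  · refine le_trans (le_of_eq ?_) (hp v)
    rw [← sum_sum_joins]
    refine Finset.sum_congr rfl fun u _ => ?_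
    by_cases huv : v = u
    · subst huv; simp [not_joins_self]
    · obtain ⟨e, he, huniq⟩ := exists_edge_joins huv
      have hfil : Finset.univ.filter (fun e => Joins e v u) = {e} := by
        ext e'
        simp only [Finset.mem_filter, Finset.mem_univ, true_and, Finset.mem_singleton]
        exact ⟨huniq e', fun h => h ▸ he⟩
      rw [hfil, Finset.sum_singleton, Finset.sum_singleton]

theorem variance_node_le (p : IsingModel n) {η : ℝ} (hη : 0 < η) (hp : p.HighTemperature η)
    (hn : 0 < n) (a : Fin n → ℝ) :
    ProbabilityTheory.variance (fun x => ∑ v, a v * nodeObs v x) p.law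
      ≤ 4 / η * ∑ v, a v ^ 2 := by
  refine (p.variance_le hη hp hn (oscBound_node a)).trans ?_
  have : ∑ v, (2 * |a v|) ^ 2 = 4 * ∑ v, a v ^ 2 := by
    rw [Finset.mul_sum]
    exact Finset.sum_congr rfl fun v _ => by rw [mul_pow, sq_abs]; ring
  rw [this, div_mul_eq_mul_div]
  have hS : 0 ≤ ∑ v, a v ^ 2 := Finset.sum_nonneg fun _ _ => sq_nonneg _
  exact div_le_div_of_nonneg_left (by positivity) hη (by linarith)

theorem variance_edge_le (p : IsingModel n) {η : ℝ} (hη : 0 < η) (hp : p.HighTemperature η)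
    (hn : 0 < n) (a : Edge n → ℝ) :
    ProbabilityTheory.variance (fun x => ∑ e, a e * edgeObs e x) p.law
      ≤ 4 / η * n * ∑ e, a e ^ 2 := by
  refine (p.variance_le hη hp hn (oscBound_edge a)).trans ?_
  have h1 : ∀ v : Fin n,
      (2 * ∑ e ∈ Finset.univ.filter (fun e : Edge n => e.1.1 = v ∨ e.1.2 = v), |a e|) ^ 2
      ≤ 4 * n * ∑ e ∈ Finset.univ.filter (fun e : Edge n => e.1.1 = v ∨ e.1.2 = v), a e ^ 2 := by
    intro v
    have h2 := sq_sum_le_card_mul_sum_sq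
      (s := Finset.univ.filter (fun e : Edge n => e.1.1 = v ∨ e.1.2 = v)) (f := fun e => |a e|)
    simp only [sq_abs] at h2
    have h3 := mul_le_mul_of_nonneg_right (card_endpoint_le v)
      (Finset.sum_nonneg fun e (_ : e ∈ Finset.univ.filter
        (fun e : Edge n => e.1.1 = v ∨ e.1.2 = v)) => sq_nonneg (a e))
    rw [mul_pow]
    linarith
  have h4 := Finset.sum_le_sum fun v (_ : v ∈ Finset.univ) => h1 v
  rw [← Finset.mul_sum, sum_sum_endpoint] at h4
  rw [div_le_iff₀ (by positivity)]
  refine h4.trans (le_of_eq ?_)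
  field_simp

end IsingModel

/-! ### The symmetrized divergence of two Ising models -/

namespace IsingModel
variable {n : ℕ}

theorem law_singleton (p : IsingModel n) (x : Config n) :
    p.law {x} = ENNReal.ofReal (p.weight x) := by
  rw [law, PMF.toMeasure_apply_singleton _ _ (measurableSet_singleton x)]
  rfl

theorem law_eq_withDensity (p q : IsingModel n) :
    p.law = q.law.withDensity fun x => ENNReal.ofReal (p.weight x / q.weight x) := by
  refine Measure.ext_of_singleton fun x => ?_
  rw [withDensity_apply _ (measurableSet_singleton x), lintegral_singleton, law_singleton,
    law_singleton, ← ENNReal.ofReal_mul (div_nonneg (p.weight_pos x).le (q.weight_pos x).le),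
    div_mul_cancel₀ _ (q.weight_pos x).ne']

theorem law_absolutelyContinuous (p q : IsingModel n) : p.law ≪ q.law := by
  rw [law_eq_withDensity p q]
  exact withDensity_absolutelyContinuous _ _

theorem integral_llr_law (p q : IsingModel n) :
    ∫ x, llr p.law q.law x ∂p.law = ∫ x, Real.log (p.weight x / q.weight x) ∂p.law := by
  refine integral_congr_ae (law_absolutelyContinuous p q ?_)
  have h := Measure.rnDeriv_withDensity q.law
    (f := fun x => ENNReal.ofReal (p.weight x / q.weight x)) (measurable_of_countable _)
  rw [← law_eq_withDensity p q] at h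
  filter_upwards [h] with x hx
  rw [llr, hx, ENNReal.toReal_ofReal (div_nonneg (p.weight_pos x).le (q.weight_pos x).le)]

theorem klDiv_law (p q : IsingModel n) :
    klDiv p.law q.law
      = ENNReal.ofReal (∫ x, Real.log (p.weight x / q.weight x) ∂p.law) := by
  rw [klDiv_of_ac_of_integrable (law_absolutelyContinuous p q) Integrable.of_finite,
    integral_llr_law]
  simp

theorem integral_log_weight_div_nonneg (p q : IsingModel n) :
    0 ≤ ∫ x, Real.log (p.weight x / q.weight x) ∂p.law := by
  have h := integral_llr_add_sub_measure_univ_nonneg (law_absolutelyContinuous p q)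
    Integrable.of_finite
  rw [integral_llr_law] at h
  simpa using h

theorem integral_exponent (p q : IsingModel n) :
    ∫ x, p.exponent x ∂q.law
      = ∑ v, p.node v * q.nodeMean v + ∑ e, p.edge e * q.edgeMean e := by
  simp only [exponent]
  rw [integral_add Integrable.of_finite Integrable.of_finite,
    integral_finsetSum _ (fun _ _ => Integrable.of_finite),
    integral_finsetSum _ (fun _ _ => Integrable.of_finite)]
  simp only [integral_const_mul]
  rfl

/-- The symmetrized divergence of two Ising models is the inner product of the differences of their
parameters and of their marginals: the two log-partition functions cancel. -/
theorem dSKL_law (p q : IsingModel n) :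
    dSKL p.law q.law = ENNReal.ofReal
      (∑ v, (p.node v - q.node v) * (p.nodeMean v - q.nodeMean v)
        + ∑ e, (p.edge e - q.edge e) * (p.edgeMean e - q.edgeMean e)) := by
  rw [dSKL, klDiv_law, klDiv_law, ← ENNReal.ofReal_add (integral_log_weight_div_nonneg p q)
    (integral_log_weight_div_nonneg q p)]
  congr 1
  have hlog : ∀ (p q : IsingModel n) (x : Config n), Real.log (p.weight x / q.weight x)
      = p.exponent x - q.exponent x + (Real.log q.partition - Real.log p.partition) := by
    intro p q x
    rw [Real.log_div (p.weight_pos x).ne' (q.weight_pos x).ne', weight, weight,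
      Real.log_div (Real.exp_pos _).ne' p.partition_pos.ne',
      Real.log_div (Real.exp_pos _).ne' q.partition_pos.ne', Real.log_exp, Real.log_exp]
    ring
  have hint : ∀ p q : IsingModel n, ∫ x, Real.log (p.weight x / q.weight x) ∂p.law
      = ∫ x, p.exponent x ∂p.law - ∫ x, q.exponent x ∂p.law
        + (Real.log q.partition - Real.log p.partition) := by
    intro p q
    simp only [hlog]
    rw [integral_add Integrable.of_finite Integrable.of_finite,
      integral_sub Integrable.of_finite Integrable.of_finite, integral_const]
    simp
  rw [hint, hint]
  simp only [integral_exponent, sub_mul, mul_sub, Finset.sum_sub_distrib]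
  ring

/-- If two Ising models with bounded parameters are far apart, then their node marginals or their
edge marginals are. -/
theorem le_of_le_dSKL {p q : IsingModel n} {ε h β : ℝ} (hp : p.BoundedBy h β)
    (hq : q.BoundedBy h β) (hfar : ENNReal.ofReal ε ≤ dSKL p.law q.law) (hε : 0 < ε) :
    ε ≤ 2 * h * ∑ v, |p.nodeMean v - q.nodeMean v|
      + 2 * β * ∑ e, |p.edgeMean e - q.edgeMean e| := by
  rw [dSKL_law] at hfar
  have h1 := (ENNReal.ofReal_le_ofReal_iff' (p := ε)).1 hfar
  have h2 : ε ≤ _ := h1.resolve_right (by linarith)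
  refine h2.trans (add_le_add ?_ ?_)
  · rw [Finset.mul_sum]
    refine Finset.sum_le_sum fun v _ => (le_abs_self _).trans ?_
    rw [abs_mul]
    refine mul_le_mul_of_nonneg_right ((abs_sub _ _).trans ?_) (abs_nonneg _)
    linarith [hp.1 v, hq.1 v]
  · rw [Finset.mul_sum]
    refine Finset.sum_le_sum fun e _ => (le_abs_self _).trans ?_
    rw [abs_mul]
    refine mul_le_mul_of_nonneg_right ((abs_sub _ _).trans ?_) (abs_nonneg _)
    linarith [hp.2 e, hq.2 e]

end IsingModel

/-! ### The sign of a sum of biased spins -/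

section SignOfSum
variable {k : ℕ}

/-- The sum of `k` spins. -/
def spinSum (y : Fin k → Bool) : ℝ := ∑ j, spin (y j)

theorem spinSum_not (y : Fin k → Bool) : spinSum (fun j => !y j) = -spinSum y := by
  simp [spinSum, spin_not]

theorem sum_comp_not (F : (Fin k → Bool) → ℝ) : ∑ y : Fin k → Bool, F (fun j => !y j) = ∑ y, F y :=
  Equiv.sum_comp (Function.Involutive.toPerm (fun (y : Fin k → Bool) j => !y j)
    (fun y => by simp)) F

theorem sum_spinSum_succ (F : ℝ → ℝ) :
    ∑ y : Fin (k + 1) → Bool, F (spinSum y)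
      = ∑ y : Fin k → Bool, (F (spinSum y + 1) + F (spinSum y - 1)) := by
  rw [← Equiv.sum_comp (Fin.consEquiv fun _ => Bool), Fintype.sum_prod_type, Fintype.sum_bool,
    ← Finset.sum_add_distrib]
  refine Finset.sum_congr rfl fun y _ => ?_
  simp [spinSum, Fin.consEquiv, Fin.sum_univ_succ, spin]
  ring_nf

theorem sum_spinSum_sq (k : ℕ) : ∑ y : Fin k → Bool, spinSum y ^ 2 = 2 ^ k * k := by
  induction k with
  | zero => simp [spinSum]
  | succ k ih =>
    rw [sum_spinSum_succ (fun s => s ^ 2)]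
    have : ∀ y : Fin k → Bool, (spinSum y + 1) ^ 2 + (spinSum y - 1) ^ 2 = 2 * spinSum y ^ 2 + 2 := by
      intro y; ring
    simp only [this, Finset.sum_add_distrib, ← Finset.mul_sum, ih]
    simp
    ring

theorem sum_spinSum_pow_four (k : ℕ) :
    ∑ y : Fin k → Bool, spinSum y ^ 4 = 2 ^ k * (3 * k ^ 2 - 2 * k) := by
  induction k with
  | zero => simp [spinSum]
  | succ k ih =>
    rw [sum_spinSum_succ (fun s => s ^ 4)]
    have : ∀ y : Fin k → Bool, (spinSum y + 1) ^ 4 + (spinSum y - 1) ^ 4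
        = 2 * spinSum y ^ 4 + 12 * spinSum y ^ 2 + 2 := by
      intro y; ring
    simp only [this, Finset.sum_add_distrib, ← Finset.mul_sum, ih, sum_spinSum_sq]
    simp
    ring

/-- The mean absolute value of a simple random walk after `k` steps is at least `√k / 2`, by the
second and fourth moments. -/
theorem sum_abs_spinSum_ge (k : ℕ) :
    2 ^ k * (√k / 2) ≤ ∑ y : Fin k → Bool, |spinSum y| := by
  rcases Nat.eq_zero_or_pos k with rfl | hk
  · simp
  have hk' : (0 : ℝ) < k := by exact_mod_cast hk
  set r := √(k : ℝ) with hr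
  have hr0 : 0 < r := Real.sqrt_pos.2 hk'
  have hr2 : r ^ 2 = k := Real.sq_sqrt hk'.le
  -- The parabola-like minorant of `|s|` that is tangent to it at `|s| = 2 r`.
  have h1 : ∀ s : ℝ, 3 / (4 * r) * s ^ 2 - 1 / (16 * r ^ 3) * s ^ 4 ≤ |s| := by
    intro s
    have hs : s ^ 2 = |s| ^ 2 := (sq_abs s).symm
    have hs4 : s ^ 4 = |s| ^ 4 := by rw [← abs_pow, abs_of_nonneg (by positivity)]
    rw [hs, hs4]
    set u := |s|
    have hu : 0 ≤ u := abs_nonneg s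
    have : 0 ≤ u * ((u - 2 * r) ^ 2 * (u + 4 * r)) / (16 * r ^ 3) := by positivity
    have e : u * ((u - 2 * r) ^ 2 * (u + 4 * r)) / (16 * r ^ 3)
        = u - (3 / (4 * r) * u ^ 2 - 1 / (16 * r ^ 3) * u ^ 4) := by
      field_simp
      ring
    linarith
  have h2 := Finset.sum_le_sum fun y (_ : y ∈ Finset.univ) => h1 (spinSum (k := k) y)
  rw [Finset.sum_sub_distrib, ← Finset.mul_sum, ← Finset.mul_sum, sum_spinSum_sq,
    sum_spinSum_pow_four] at h2
  refine le_trans ?_ h2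
  have e : 3 / (4 * r) * (2 ^ k * (k : ℝ)) - 1 / (16 * r ^ 3) * (2 ^ k * (3 * (k : ℝ) ^ 2 - 2 * k))
      = 2 ^ k * (9 / 16 * r + 1 / (8 * r)) := by
    rw [← hr2]
    field_simp
    ring
  rw [e]
  have : 0 < 1 / (8 * r) := by positivity
  exact mul_le_mul_of_nonneg_left (by linarith) (by positivity)

/-- The mean of the sign of the sum of `k` independent spins of mean `a`. -/
def signMean (k : ℕ) (a : ℝ) : ℝ :=
  ∑ y : Fin k → Bool, (∏ j, (1 + a * spin (y j)) / 2) * Real.sign (spinSum y)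

theorem signMean_neg (k : ℕ) (a : ℝ) : signMean k (-a) = -signMean k a := by
  rw [signMean, ← sum_comp_not, signMean, ← Finset.sum_neg_distrib]
  refine Finset.sum_congr rfl fun y _ => ?_
  rw [spinSum_not, Real.sign_neg]
  simp [spin_not]

theorem two_mul_le_pow_sub_pow {a : ℝ} (h0 : 0 ≤ a) (h1 : a ≤ 1) (r : ℕ) :
    2 * a * r ≤ (1 + a) ^ r - (1 - a) ^ r := by
  induction r with
  | zero => simp
  | succ r ih =>
    have b1 := one_add_mul_le_pow (by linarith : (-2 : ℝ) ≤ a) r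
    have b2 := one_add_mul_le_pow (by linarith : (-2 : ℝ) ≤ -a) r
    rw [← sub_eq_add_neg] at b2
    have e : (1 + a) ^ (r + 1) - (1 - a) ^ (r + 1)
        = ((1 + a) ^ r - (1 - a) ^ r) + a * ((1 + a) ^ r + (1 - a) ^ r) := by ring
    rw [e]
    push_cast
    nlinarith

theorem prod_one_add_mul_spin (a : ℝ) (y : Fin k → Bool) :
    ∃ p q : ℕ, p + q = k ∧ spinSum y = p - q ∧ ∏ j, (1 + a * spin (y j)) = (1 + a) ^ p * (1 - a) ^ q
      ∧ ∏ j, (1 - a * spin (y j)) = (1 - a) ^ p * (1 + a) ^ q := by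
  refine ⟨(Finset.univ.filter fun j => y j = true).card,
    (Finset.univ.filter fun j => ¬ y j = true).card, ?_, ?_, ?_, ?_⟩
  · rw [Finset.card_filter_add_card_filter_not]; simp
  · have : ∀ j, spin (y j) = (if y j = true then 1 else 0) - (if ¬ y j = true then (1 : ℝ) else 0) := by
      intro j; cases y j <;> simp [spin]
    simp only [spinSum, this, Finset.sum_sub_distrib, Finset.sum_boole]
  · have : ∀ j, 1 + a * spin (y j) = if y j = true then 1 + a else 1 - a := by
      intro j; cases y j <;> simp [spin]; ring
    simp only [this, Finset.prod_ite, Finset.prod_const]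
  · have : ∀ j, 1 - a * spin (y j) = if y j = true then 1 - a else 1 + a := by
      intro j; cases y j <;> simp [spin]
    simp only [this, Finset.prod_ite, Finset.prod_const]

theorem sign_mul_prod_sub_ge {a : ℝ} (h0 : 0 ≤ a) (h1 : a ≤ 1) (hk : k * a ^ 2 ≤ 1)
    (y : Fin k → Bool) :
    (1 - k * a ^ 2) * (2 * a * |spinSum y|)
      ≤ Real.sign (spinSum y) * (∏ j, (1 + a * spin (y j)) - ∏ j, (1 - a * spin (y j))) := by
  obtain ⟨p, q, hpq, hS, hP, hQ⟩ := prod_one_add_mul_spin a y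
  have key : ∀ q r : ℕ, q ≤ k →
      (1 - k * a ^ 2) * (2 * a * r) ≤ (1 - a ^ 2) ^ q * ((1 + a) ^ r - (1 - a) ^ r) := by
    intro q r hq
    have ha2 : a ^ 2 ≤ 1 := by nlinarith
    have b := one_add_mul_le_pow (by linarith : (-2 : ℝ) ≤ -a ^ 2) q
    have hq' : (q : ℝ) ≤ k := by exact_mod_cast hq
    have b' : 1 - k * a ^ 2 ≤ (1 - a ^ 2) ^ q := by
      rw [sub_eq_add_neg 1 (a ^ 2)]
      nlinarith [sq_nonneg a]
    exact mul_le_mul b' (two_mul_le_pow_sub_pow h0 h1 r) (by positivity) (by linarith)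
  have e : (1 - a ^ 2) = (1 + a) * (1 - a) := by ring
  rw [hP, hQ, hS]
  rcases lt_trichotomy p q with h | h | h
  · obtain ⟨r, rfl⟩ := Nat.exists_eq_add_of_lt h
    have hneg : (p : ℝ) - ((p + r + 1 : ℕ) : ℝ) = -((r + 1 : ℕ) : ℝ) := by push_cast; ring
    have hk1 := key p (r + 1) (by omega)
    rw [hneg, Real.sign_of_neg (by push_cast; linarith [(Nat.cast_nonneg r : (0 : ℝ) ≤ r)]), abs_neg,
      Nat.abs_cast]
    refine hk1.trans (le_of_eq ?_)
    rw [e, mul_pow]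
    ring
  · subst h; simp
  · obtain ⟨r, rfl⟩ := Nat.exists_eq_add_of_lt h
    have hpos : ((q + r + 1 : ℕ) : ℝ) - (q : ℝ) = ((r + 1 : ℕ) : ℝ) := by push_cast; ring
    have hk1 := key q (r + 1) (by omega)
    rw [hpos, Real.sign_of_pos (by positivity), Nat.abs_cast]
    refine hk1.trans (le_of_eq ?_)
    rw [e, mul_pow]
    ring

/-- **Amplification of a bias by majority vote.** In the range `a ≲ 1 / √k`, the sign of the sum of
`k` spins of mean `a` has a mean of order `√k · a`. -/
theorem mul_signMean_ge {k : ℕ} {a : ℝ} (ha : |a| * (2 * √k) ≤ 1) (ha1 : |a| ≤ 1) :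
    3 / 8 * √k * a ^ 2 ≤ a * signMean k a := by
  have key : ∀ a : ℝ, 0 ≤ a → a * (2 * √k) ≤ 1 → a ≤ 1 → 3 / 8 * √k * a ≤ signMean k a := by
    intro a h0 h h1
    have hk4 : k * a ^ 2 ≤ 1 / 4 := by
      have : (k : ℝ) = √k ^ 2 := (Real.sq_sqrt (Nat.cast_nonneg k)).symm
      rw [this]
      have h3 : 0 ≤ a * (2 * √k) := by positivity
      nlinarith
    have h2 : 2 * signMean k a = (1 / 2) ^ k * ∑ y : Fin k → Bool, Real.sign (spinSum y)
        * (∏ j, (1 + a * spin (y j)) - ∏ j, (1 - a * spin (y j))) := by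
      have e1 : signMean k a = (1 / 2) ^ k * ∑ y : Fin k → Bool, Real.sign (spinSum y)
          * ∏ j, (1 + a * spin (y j)) := by
        rw [signMean, Finset.mul_sum]
        refine Finset.sum_congr rfl fun y _ => ?_
        rw [Finset.prod_div_distrib, Finset.prod_const, Finset.card_univ, Fintype.card_fin,
          one_div, inv_pow]
        ring
      have e2 : ∑ y : Fin k → Bool, Real.sign (spinSum y) * ∏ j, (1 + a * spin (y j))
          = -∑ y : Fin k → Bool, Real.sign (spinSum y) * ∏ j, (1 - a * spin (y j)) := by
        rw [← sum_comp_not, ← Finset.sum_neg_distrib]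
        refine Finset.sum_congr rfl fun y _ => ?_
        rw [spinSum_not, Real.sign_neg]
        simp only [spin_not, mul_neg, ← sub_eq_add_neg, neg_mul]
      simp only [mul_sub, Finset.sum_sub_distrib]
      rw [two_mul]
      nth_rewrite 1 [e1]
      rw [e1, e2]
      ring
    have h3 := Finset.sum_le_sum fun y (_ : y ∈ Finset.univ) =>
      sign_mul_prod_sub_ge (k := k) h0 h1 (by linarith) y
    rw [← Finset.mul_sum, ← Finset.mul_sum] at h3
    have h4 := sum_abs_spinSum_ge k
    have h5 : (1 - k * a ^ 2) * (2 * a * (2 ^ k * (√k / 2)))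
        ≤ ∑ y : Fin k → Bool, Real.sign (spinSum y)
          * (∏ j, (1 + a * spin (y j)) - ∏ j, (1 - a * spin (y j))) :=
      le_trans (mul_le_mul_of_nonneg_left (mul_le_mul_of_nonneg_left h4 (by linarith))
        (by linarith)) h3
    have h6 := mul_le_mul_of_nonneg_left h5 (by positivity : (0 : ℝ) ≤ (1 / 2) ^ k)
    rw [← h2] at h6
    have h7 : (1 / 2 : ℝ) ^ k * ((1 - k * a ^ 2) * (2 * a * (2 ^ k * (√k / 2))))
        = (1 - k * a ^ 2) * (a * √k) := by
      have : (1 / 2 : ℝ) ^ k * 2 ^ k = 1 := by rw [← mul_pow]; norm_num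
      linear_combination ((1 - k * a ^ 2) * (a * √k)) * this
    rw [h7] at h6
    have h8 : 0 ≤ a * √k := by positivity
    nlinarith
  rcases le_total 0 a with h0 | h0
  · rw [abs_of_nonneg h0] at ha ha1
    nlinarith [key a h0 ha ha1]
  · rw [abs_of_nonpos h0] at ha ha1
    have := key (-a) (by linarith) ha ha1
    rw [signMean_neg] at this
    nlinarith

end SignOfSum

/-! ### Concentration and amplification for finite product measures -/

section Tools
variable {α β Ω : Type} [MeasurableSpace α] [MeasurableSpace β] [MeasurableSpace Ω]

theorem integral_average_pi [Finite Ω] [MeasurableSingletonClass Ω] (P : Measure Ω)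
    [IsProbabilityMeasure P] (f : Ω → ℝ) {m : ℕ} (hm : 0 < m) :
    ∫ x : Fin m → Ω, (∑ j, f (x j)) / m ∂Measure.pi (fun _ => P) = ∫ x, f x ∂P := by
  have hm' : (m : ℝ) ≠ 0 := by exact_mod_cast hm.ne'
  rw [integral_div, integral_finsetSum _ (fun _ _ => Integrable.of_finite)]
  have : ∀ j : Fin m, ∫ x : Fin m → Ω, f (x j) ∂Measure.pi (fun _ => P) = ∫ x, f x ∂P := fun j =>
    integral_comp_eval (μ := fun _ : Fin m => P) (f := f) (measurable_of_countable f).aestronglyMeasurable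
  simp only [this, Finset.sum_const, Finset.card_univ, Fintype.card_fin, nsmul_eq_mul]
  field_simp

theorem real_meas_ge_le_variance_div_sq [Finite Ω] [MeasurableSingletonClass Ω] (P : Measure Ω)
    [IsProbabilityMeasure P] (f : Ω → ℝ) {s : ℝ} (hs : 0 < s) :
    P.real {x | s ≤ |f x - ∫ y, f y ∂P|} ≤ variance f P / s ^ 2 := by
  have h := meas_ge_le_variance_div_sq (μ := P) (MemLp.of_discrete (f := f)) hs
  exact ENNReal.toReal_le_of_le_ofReal (div_nonneg (variance_nonneg _ _) (sq_nonneg _)) h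

/-- Chebyshev's inequality for the average of a batch of i.i.d. samples. -/
theorem average_deviation_le_variance [Finite Ω] [MeasurableSingletonClass Ω] (P : Measure Ω)
    [IsProbabilityMeasure P] (f : Ω → ℝ) {m : ℕ} (hm : 0 < m) {V s : ℝ} (hV : variance f P ≤ V)
    (hs : 0 < s) :
    (Measure.pi fun _ : Fin m => P).real {x | s ≤ |(∑ j, f (x j)) / m - ∫ y, f y ∂P|}
      ≤ V / (m * s ^ 2) := by
  have hm' : (0 : ℝ) < m := by exact_mod_cast hm
  have h := real_meas_ge_le_variance_div_sq (Measure.pi fun _ : Fin m => P)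
    (fun x => (∑ j, f (x j)) / m) hs
  rw [integral_average_pi P f hm] at h
  refine h.trans ?_
  have hvar : variance (fun x : Fin m → Ω => (∑ j, f (x j)) / m) (Measure.pi fun _ => P)
      = variance f P / m := by
    have h1 := variance_sum_pi (μ := fun _ : Fin m => P) (X := fun _ => f)
      (fun _ => MemLp.of_discrete)
    have h2 : (fun x : Fin m → Ω => (∑ j, f (x j)) / m)
        = fun x => (1 / (m : ℝ)) * (∑ j : Fin m, fun x : Fin m → Ω => f (x j)) x := by
      funext x; rw [Finset.sum_apply]; ring
    rw [h2, variance_const_mul, h1]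
    simp
    field_simp
  rw [hvar, div_div]
  gcongr

/-- Hoeffding's inequality for the average of i.i.d. samples of an observable bounded by one. -/
theorem average_deviation_le_exp [Finite Ω] [MeasurableSingletonClass Ω] (P : Measure Ω)
    [IsProbabilityMeasure P] (f : Ω → ℝ) (hf : ∀ x, |f x| ≤ 1) {m : ℕ} (hm : 0 < m) {s : ℝ}
    (hs : 0 ≤ s) :
    (Measure.pi fun _ : Fin m => P).real {x | s ≤ |(∑ j, f (x j)) / m - ∫ y, f y ∂P|}
      ≤ 2 * Real.exp (-(m * s ^ 2 / 2)) := by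
  have hm' : (0 : ℝ) < m := by exact_mod_cast hm
  set Q := Measure.pi fun _ : Fin m => P
  have one_sided : ∀ f : Ω → ℝ, (∀ x, |f x| ≤ 1) →
      Q.real {x | m * s ≤ ∑ j, (f (x j) - ∫ y, f y ∂P)} ≤ Real.exp (-(m * s ^ 2 / 2)) := by
    intro f hf
    have hind : iIndepFun (fun (j : Fin m) (x : Fin m → Ω) => f (x j) - ∫ y, f y ∂P) Q :=
      iIndepFun_pi (X := fun _ y => f y - ∫ y, f y ∂P)
        (fun _ => (measurable_of_countable _).aemeasurable)
    have hsub : ∀ j ∈ (Finset.univ : Finset (Fin m)),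
        HasSubgaussianMGF (fun x : Fin m → Ω => f (x j) - ∫ y, f y ∂P) 1 Q := by
      intro j _
      have h := hasSubgaussianMGF_of_mem_Icc (μ := Q) (X := fun x => f (x j)) (a := -1) (b := 1)
        (measurable_of_countable _).aemeasurable
        (Filter.Eventually.of_forall fun x => abs_le.1 (hf _))
      have e : ∫ x, f (x j) ∂Q = ∫ y, f y ∂P :=
        integral_comp_eval (μ := fun _ : Fin m => P) (f := f) (measurable_of_countable f).aestronglyMeasurable
      rw [e] at h
      convert h using 1
      norm_num
    refine (HasSubgaussianMGF.measure_sum_ge_le_of_iIndepFun hind hsub (by positivity)).trans (le_of_eq ?_)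
    congr 1
    simp
    field_simp
  have h1 := one_sided f hf
  have h2 := one_sided (fun x => -f x) (fun x => by rw [abs_neg]; exact hf x)
  rw [two_mul]
  refine le_trans (measureReal_mono (fun x hx => ?_)) ((measureReal_union_le _ _).trans
    (add_le_add h1 h2))
  have hx' : s ≤ |(∑ j, f (x j)) / m - ∫ y, f y ∂P| := hx
  have e : (∑ j, f (x j)) / m - ∫ y, f y ∂P = (∑ j, (f (x j) - ∫ y, f y ∂P)) / m := by
    rw [Finset.sum_sub_distrib]; simp; field_simp
  rw [e, abs_div, abs_of_pos hm', le_div_iff₀ hm'] at hx'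
  rcases le_abs.1 hx' with h | h
  · left
    change m * s ≤ _
    linarith
  · right
    change m * s ≤ ∑ j, (-f (x j) - ∫ y, -f y ∂P)
    rw [integral_neg]
    have : ∑ j, (-f (x j) - -∫ y, f y ∂P) = -∑ j, (f (x j) - ∫ y, f y ∂P) := by
      rw [← Finset.sum_neg_distrib]; exact Finset.sum_congr rfl fun _ _ => by ring
    rw [this]; linarith

open Classical in
/-- Amplification by repetition: an event of probability at most `1 / 16` occurs in half of `R`
independent trials with probability at most `2⁻ᴿ`. -/
theorem half_of_trials_le [Finite Ω] [MeasurableSingletonClass Ω] (P : Measure Ω)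
    [IsProbabilityMeasure P] (E : Set Ω) (hE : P.real E ≤ 1 / 16) (R : ℕ) :
    (Measure.pi fun _ : Fin R => P).real
      {c | R ≤ 2 * (Finset.univ.filter fun t => c t ∈ E).card} ≤ (1 / 2) ^ R := by
  set Q := Measure.pi fun _ : Fin R => P
  have h := mul_meas_ge_le_integral_of_nonneg (μ := Q)
    (f := fun c => ∏ t, if c t ∈ E then (16 : ℝ) else 1)
    (Filter.Eventually.of_forall fun c => Finset.prod_nonneg fun t _ => by split_ifs <;> norm_num)
    Integrable.of_finite (4 ^ R)
  rw [integral_fintype_prod_eq_pow (f := fun y => if y ∈ E then (16 : ℝ) else 1)] at h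
  have hint : ∫ y, (if y ∈ E then (16 : ℝ) else 1) ∂P ≤ 2 := by
    have e : (fun y => if y ∈ E then (16 : ℝ) else 1) = fun y => 1 + E.indicator (fun _ => 15) y := by
      funext y; by_cases hy : y ∈ E <;> simp [hy]; norm_num
    rw [e, integral_add Integrable.of_finite Integrable.of_finite,
      integral_indicator (Set.toFinite E).measurableSet]
    simp only [integral_const, measureReal_restrict_apply_univ, smul_eq_mul, probReal_univ]
    linarith
  have hint0 : 0 ≤ ∫ y, (if y ∈ E then (16 : ℝ) else 1) ∂P :=
    integral_nonneg fun y => by dsimp only; split_ifs <;> norm_num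
  have h2 := h.trans (pow_le_pow_left₀ hint0 hint _)
  rw [Fintype.card_fin] at h2
  have hsub : {c : Fin R → Ω | R ≤ 2 * (Finset.univ.filter fun t => c t ∈ E).card}
      ⊆ {c | (4 : ℝ) ^ R ≤ ∏ t, if c t ∈ E then (16 : ℝ) else 1} := by
    intro c hc
    have hc' : R ≤ 2 * (Finset.univ.filter fun t => c t ∈ E).card := hc
    change (4 : ℝ) ^ R ≤ _
    rw [Finset.prod_ite, Finset.prod_const, Finset.prod_const_one, mul_one,
      show (16 : ℝ) = 4 ^ 2 by norm_num, ← pow_mul]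
    exact pow_le_pow_right₀ (by norm_num) hc'
  have h3 := measureReal_mono (μ := Q) hsub
  have h4 : (4 : ℝ) ^ R = 2 ^ R * 2 ^ R := by rw [← mul_pow]; norm_num
  rw [h4, mul_assoc] at h2
  have h5 : (2 : ℝ) ^ R * Q.real {c | 2 ^ R * 2 ^ R ≤ ∏ t, if c t ∈ E then (16 : ℝ) else 1} ≤ 1 := by
    by_contra hcon
    push Not at hcon
    have := mul_lt_mul_of_pos_left hcon (by positivity : (0 : ℝ) < 2 ^ R)
    linarith
  rw [h4] at h3
  rw [div_pow, one_pow, le_div_iff₀ (by positivity)]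
  nlinarith [pow_pos (by norm_num : (0 : ℝ) < 2) R]

theorem prod_real_le_of_section [Finite α] [Finite β] [MeasurableSingletonClass α]
    [MeasurableSingletonClass β] (μ : Measure α) (ν : Measure β) [IsProbabilityMeasure μ]
    [IsProbabilityMeasure ν] (S : α → Set β) {b : ℝ} (hb : ∀ a, ν.real (S a) ≤ b) :
    (μ.prod ν).real {z | z.2 ∈ S z.1} ≤ b := by
  have hb0 : 0 ≤ b := by
    obtain ⟨a⟩ : Nonempty α := by
      by_contra h
      rw [not_nonempty_iff] at h
      have := measure_univ (μ := μ)
      rw [Set.univ_eq_empty_iff.2 h, measure_empty] at this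
      exact zero_ne_one this
    exact measureReal_nonneg.trans (hb a)
  refine ENNReal.toReal_le_of_le_ofReal hb0 ?_
  rw [Measure.prod_apply (Set.toFinite _).measurableSet]
  calc ∫⁻ a, ν (Prod.mk a ⁻¹' {z | z.2 ∈ S z.1}) ∂μ ≤ ∫⁻ _a, ENNReal.ofReal b ∂μ := by
        refine lintegral_mono fun a => ?_
        change ν (S a) ≤ _
        rw [← ENNReal.ofReal_toReal (measure_ne_top ν (S a))]
        exact ENNReal.ofReal_le_ofReal (hb a)
    _ = ENNReal.ofReal b := by simp

theorem pi_real_forall_mem (Q : Measure α) [IsProbabilityMeasure Q] (E : Set α) (L : ℕ) :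
    (Measure.pi fun _ : Fin L => Q).real {b | ∀ l, b l ∈ E} = Q.real E ^ L := by
  have : {b : Fin L → α | ∀ l, b l ∈ E} = Set.univ.pi fun _ => E := by ext; simp
  rw [this, measureReal_def, Measure.pi_pi]
  simp [measureReal_def]

theorem prod_singleton_eq_mul (μ : Measure α) (ν : Measure β) [SFinite ν] (z : α × β) :
    μ.prod ν {z} = μ {z.1} * ν {z.2} := by
  rw [← Measure.prod_prod, Set.singleton_prod_singleton]

/-- A bijection of finite spaces that preserves the masses of points is measure preserving. -/
theorem measurePreserving_of_singleton [Finite α] [Finite β] [MeasurableSingletonClass α]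
    [MeasurableSingletonClass β] {μ : Measure α} {ν : Measure β} (e : α ≃ β)
    (h : ∀ b, μ {e.symm b} = ν {b}) : MeasurePreserving e μ ν := by
  refine ⟨measurable_of_countable _, Measure.ext_of_singleton fun b => ?_⟩
  rw [Measure.map_apply (measurable_of_countable _) (measurableSet_singleton b), ← h b]
  congr 1
  ext a
  simp [Equiv.eq_symm_apply]

/-- A bounded variable exceeds half of its mean with a probability of the order of this mean. -/
theorem reverse_markov [Finite Ω] [MeasurableSingletonClass Ω] (P : Measure Ω)
    [IsProbabilityMeasure P] (T : Ω → ℝ) {D t : ℝ} (hD : ∀ x, T x ≤ D) (hD0 : 0 < D)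
    (ht0 : 0 ≤ t) (ht : 2 * t ≤ ∫ x, T x ∂P) : t / D ≤ P.real {x | t ≤ T x} := by
  have h1 : ∀ x, T x ≤ {x | t ≤ T x}.indicator (fun _ => D) x + t := by
    intro x
    by_cases hx : t ≤ T x
    · rw [Set.indicator_of_mem (by exact hx)]; linarith [hD x]
    · rw [Set.indicator_of_notMem (by exact hx)]; linarith
  have h2 : ∫ x, T x ∂P ≤ ∫ x, ({x | t ≤ T x}.indicator (fun _ => D) x + t) ∂P :=
    integral_mono Integrable.of_finite Integrable.of_finite h1
  rw [integral_add Integrable.of_finite Integrable.of_finite,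
    integral_indicator (Set.toFinite _).measurableSet] at h2
  simp only [integral_const, measureReal_restrict_apply_univ, smul_eq_mul, probReal_univ] at h2
  rw [div_le_iff₀ hD0]
  linarith

end Tools

/-! ### A round of weak learning -/

section Rounds

instance isProbabilityMeasure_fairCoin : IsProbabilityMeasure (rademacher (1 / 2)) :=
  rademacher_isProbabilityMeasure (by norm_num) (by norm_num)

instance isProbabilityMeasure_simulatedSpin {ι : Type} {mean : ι → ℝ}
    [h : Fact (∀ i, |mean i| ≤ 1)] (i : ι) :
    IsProbabilityMeasure (rademacher (1 / 2 + mean i / 2)) := by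
  have := abs_le.1 (h.out i)
  exact rademacher_isProbabilityMeasure (by linarith) (by linarith)

theorem integral_rademacher {s : ℝ} (h0 : 0 ≤ s) (h1 : s ≤ 1) (f : Bool → ℝ) :
    ∫ b, f b ∂rademacher s = s * f true + (1 - s) * f false := by
  have h : ∀ (c : ℝ) (b : Bool), Integrable f (ENNReal.ofReal c • Measure.dirac b) := fun c b =>
    (Integrable.of_finite (μ := Measure.dirac b)).smul_measure ENNReal.ofReal_ne_top
  rw [rademacher, integral_add_measure (h _ _) (h _ _), integral_smul_measure,
    integral_smul_measure, integral_dirac, integral_dirac, ENNReal.toReal_ofReal h0,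
    ENNReal.toReal_ofReal (by linarith)]
  simp

theorem abs_recentre {X : ℝ} (hX : |X| = 1) (Y c : Bool) : |recentre X Y c| = 1 := by
  rcases (abs_eq zero_le_one).1 hX with rfl | rfl <;> cases Y <;> cases c <;>
    norm_num [recentre, spin]

/-- The recentring by a simulated spin of mean `m` halves the conditional mean `X - m`. -/
theorem integral_recentre {X m : ℝ} (hX : |X| = 1) (hm : |m| ≤ 1) :
    ∫ z, recentre X z.1 z.2 ∂((rademacher (1 / 2 + m / 2)).prod (rademacher (1 / 2)))
      = (X - m) / 2 := by
  have hm' := abs_le.1 hm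
  have := rademacher_isProbabilityMeasure (s := 1 / 2 + m / 2) (by linarith) (by linarith)
  rw [integral_prod _ Integrable.of_finite]
  simp only [integral_rademacher (by norm_num : (0 : ℝ) ≤ 1 / 2) (by norm_num)]
  rw [integral_rademacher (by linarith) (by linarith)]
  rcases (abs_eq zero_le_one).1 hX with rfl | rfl <;> norm_num [recentre, spin] <;> ring

variable {ι Ω : Type} [Fintype ι] [MeasurableSpace Ω] [Fintype Ω] [MeasurableSingletonClass Ω]

/-- The law of one sample together with its simulated spins and coins. -/
def cellLaw (P : Measure Ω) (mean : ι → ℝ) : Measure (Ω × (ι → Bool × Bool)) :=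
  P.prod (Measure.pi fun i => (rademacher (1 / 2 + mean i / 2)).prod (rademacher (1 / 2)))

/-- The data of one round of weak learning: `k` samples with their simulated spins and coins, and a
tie-breaking coin for each observable. -/
abbrev RoundSpace (k : ℕ) (ι Ω : Type) : Type := (Fin k → Ω × (ι → Bool × Bool)) × (ι → Bool)

/-- The law of the data of one round of weak learning. -/
def roundLaw (k : ℕ) (P : Measure Ω) (mean : ι → ℝ) : Measure (RoundSpace k ι Ω) :=
  (Measure.pi fun _ => cellLaw P mean).prod (Measure.pi fun _ => rademacher (1 / 2))

/-- The recentred spin of the observable `i`, as a function of a sample and its randomness. -/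
def recentredSpin (obs : ι → Ω → ℝ) (i : ι) (c : Ω × (ι → Bool × Bool)) : ℝ :=
  recentre (obs i c.1) (c.2 i).1 (c.2 i).2

/-- The sign that a round of weak learning assigns to the observable `i`. -/
def roundSign {k : ℕ} (obs : ι → Ω → ℝ) (ω : RoundSpace k ι Ω) (i : ι) : ℝ :=
  if 0 < ∑ j, recentredSpin obs i (ω.1 j) then 1
  else if ∑ j, recentredSpin obs i (ω.1 j) < 0 then -1 else spin (ω.2 i)

/-- The bias `E[g_i] - m_i` of an observable. -/
def bias (P : Measure Ω) (obs : ι → Ω → ℝ) (mean : ι → ℝ) (i : ι) : ℝ :=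
  ∫ x, obs i x ∂P - mean i

/-- The correlation `∑ Γ_i (E[g_i] - m_i)` of a sign vector with the biases: the mean of the test
statistic. -/
def corr (P : Measure Ω) (obs : ι → Ω → ℝ) (mean : ι → ℝ) (Γ : ι → ℝ) : ℝ :=
  ∑ i, bias P obs mean i * Γ i

variable (P : Measure Ω) [IsProbabilityMeasure P] {obs : ι → Ω → ℝ} (hobs : ∀ i x, |obs i x| = 1)
  {mean : ι → ℝ} [hmean : Fact (∀ i, |mean i| ≤ 1)]

instance isProbabilityMeasure_cellLaw : IsProbabilityMeasure (cellLaw P mean) := by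
  unfold cellLaw; infer_instance

instance isProbabilityMeasure_roundLaw (k : ℕ) : IsProbabilityMeasure (roundLaw k P mean) := by
  unfold roundLaw; infer_instance

omit [Fintype ι] [MeasurableSpace Ω] [Fintype Ω] [MeasurableSingletonClass Ω] in
theorem abs_roundSign {k : ℕ} (ω : RoundSpace k ι Ω) (i : ι) : |roundSign obs ω i| = 1 := by
  unfold roundSign
  split_ifs
  · simp
  · simp
  · exact abs_spin _

include hobs

omit [MeasurableSpace Ω] [Fintype Ω] [MeasurableSingletonClass Ω] in
theorem integral_seed_recentre (x : Ω) (i : ι) :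
    ∫ s, recentredSpin obs i (x, s)
        ∂(Measure.pi fun i => (rademacher (1 / 2 + mean i / 2)).prod (rademacher (1 / 2)))
      = (obs i x - mean i) / 2 := by
  rw [← integral_recentre (hobs i x) (hmean.out i)]
  exact integral_comp_eval
    (μ := fun i : ι => (rademacher (1 / 2 + mean i / 2)).prod (rademacher (1 / 2))) (i := i)
    (f := fun z => recentre (obs i x) z.1 z.2) (measurable_of_countable _).aestronglyMeasurable

theorem integral_recentredSpin (i : ι) :
    ∫ c, recentredSpin obs i c ∂cellLaw P mean = bias P obs mean i / 2 := by
  rw [cellLaw, integral_prod _ Integrable.of_finite]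
  simp only [integral_seed_recentre hobs]
  rw [integral_div, integral_sub Integrable.of_finite Integrable.of_finite]
  simp [bias]

omit [Fintype ι] [MeasurableSpace Ω] [Fintype Ω] [MeasurableSingletonClass Ω] in
theorem exists_bool_recentredSpin (i : ι) :
    ∃ z : Ω × (ι → Bool × Bool) → Bool, ∀ c, recentredSpin obs i c = spin (z c) := by
  refine ⟨fun c => decide (0 < recentredSpin obs i c), fun c => ?_⟩
  have h : |recentredSpin obs i c| = 1 := abs_recentre (hobs i c.1) _ _
  rcases (abs_eq zero_le_one).1 h with h | h <;> norm_num [h, spin]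

omit hobs in
theorem real_singleton_of_integral_spin (ν : Measure Bool) [IsProbabilityMeasure ν] (b : Bool) :
    ν.real {b} = (1 + (∫ y, spin y ∂ν) * spin b) / 2 := by
  have h1 : ∫ y, spin y ∂ν = ν.real {true} - ν.real {false} := by
    rw [integral_fintype Integrable.of_finite]
    simp [spin]
    ring
  have h2 : ν.real {true} + ν.real {false} = 1 := by
    have := integral_fintype (μ := ν) (f := fun _ : Bool => (1 : ℝ)) Integrable.of_finite
    rw [integral_const, probReal_univ, Fintype.sum_bool] at this
    simpa using this.symm
  rw [h1]
  cases b <;> simp [spin] <;> linarith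

omit hobs in
theorem integral_sign_spinSum (k : ℕ) (ν : Measure Bool) [IsProbabilityMeasure ν] :
    ∫ y, Real.sign (spinSum y) ∂(Measure.pi fun _ : Fin k => ν)
      = signMean k (∫ y, spin y ∂ν) := by
  rw [integral_fintype Integrable.of_finite, signMean]
  refine Finset.sum_congr rfl fun y _ => ?_
  rw [measureReal_def, Measure.pi_singleton, ENNReal.toReal_prod, smul_eq_mul]
  congr 1
  exact Finset.prod_congr rfl fun j _ => real_singleton_of_integral_spin ν (y j)

/-- The mean of a learnt sign: the recentred spins are i.i.d. spins of mean `bias / 2`. -/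
theorem integral_roundSign (k : ℕ) (i : ι) :
    ∫ ω, roundSign obs ω i ∂roundLaw k P mean = signMean k (bias P obs mean i / 2) := by
  obtain ⟨z, hz⟩ := exists_bool_recentredSpin hobs i
  rw [roundLaw, integral_prod _ Integrable.of_finite]
  have hin : ∀ c : Fin k → Ω × (ι → Bool × Bool),
      ∫ r, roundSign obs (c, r) i ∂(Measure.pi fun _ : ι => rademacher (1 / 2))
        = Real.sign (spinSum fun j => z (c j)) := by
    intro c
    have hS : spinSum (fun j => z (c j)) = ∑ j, recentredSpin obs i (c j) := by
      simp only [spinSum, hz]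
    rw [hS]
    unfold roundSign
    rcases lt_trichotomy (∑ j, recentredSpin obs i (c j)) 0 with h | h | h
    · simp only [h, not_lt.2 h.le, Real.sign_of_neg h, if_true, if_false, integral_const,
        probReal_univ, one_smul]
    · simp only [h, lt_irrefl, if_false, Real.sign_zero]
      rw [integral_comp_eval (μ := fun _ : ι => rademacher (1 / 2)) (i := i) (f := spin)
        (measurable_of_countable _).aestronglyMeasurable,
        integral_rademacher (by norm_num) (by norm_num)]
      norm_num [spin]
    · simp only [h, Real.sign_of_pos h, if_true, integral_const, probReal_univ, one_smul]
  simp only [hin]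
  have hzm : Measurable z := measurable_of_countable _
  have : IsProbabilityMeasure ((cellLaw P mean).map z) := Measure.isProbabilityMeasure_map hzm.aemeasurable
  have hmap := Measure.pi_map_pi (μ := fun _ : Fin k => cellLaw P mean) (f := fun _ => z)
    (fun _ => hzm.aemeasurable)
  have h1 : ∫ c, Real.sign (spinSum fun j => z (c j)) ∂(Measure.pi fun _ : Fin k => cellLaw P mean)
      = ∫ y, Real.sign (spinSum y) ∂(Measure.pi fun _ : Fin k => (cellLaw P mean).map z) := by
    rw [← hmap, integral_map (measurable_of_countable _).aemeasurable
      (measurable_of_countable _).aestronglyMeasurable]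
  rw [h1, integral_sign_spinSum, integral_map hzm.aemeasurable
    (measurable_of_countable _).aestronglyMeasurable, ← integral_recentredSpin P hobs]
  simp only [hz]

/-- The mean correlation of a learnt sign vector with the biases, for biases below the localization
scale `1 / √k`. -/
theorem integral_corr_roundSign_ge (k : ℕ) (hloc : ∀ i, |bias P obs mean i| * √k ≤ 1) :
    3 / 16 * √k * ∑ i, bias P obs mean i ^ 2
      ≤ ∫ ω, corr P obs mean (roundSign obs ω) ∂roundLaw k P mean := by
  unfold corr
  rw [integral_finsetSum _ (fun _ _ => Integrable.of_finite), Finset.mul_sum]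
  refine Finset.sum_le_sum fun i _ => ?_
  rw [integral_const_mul, integral_roundSign P hobs]
  have h1 : |∫ x, obs i x ∂P| ≤ 1 := by
    refine (norm_integral_le_of_norm_le_const (C := 1)
      (Filter.Eventually.of_forall fun x => (Real.norm_eq_abs _).trans_le (hobs i x).le)).trans ?_
    simp
  have h2 : |bias P obs mean i| ≤ 2 := by
    refine (abs_sub _ _).trans ?_
    linarith [hmean.out i]
  have habs : |bias P obs mean i / 2| = |bias P obs mean i| / 2 := by
    rw [abs_div, abs_two]
  have := mul_signMean_ge (k := k) (a := bias P obs mean i / 2)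
    (by rw [habs]; linarith [hloc i]) (by rw [habs]; linarith)
  nlinarith

omit hobs hmean [IsProbabilityMeasure P] [MeasurableSingletonClass Ω] [Fintype Ω] in
theorem sq_sum_abs_bias_le {N : ℝ} (hN : (Fintype.card ι : ℝ) ≤ N) :
    (∑ i, |bias P obs mean i|) ^ 2 ≤ N * ∑ i, bias P obs mean i ^ 2 := by
  have h := sq_sum_le_card_mul_sum_sq (s := (Finset.univ : Finset ι))
    (f := fun i => |bias P obs mean i|)
  simp only [sq_abs, Finset.card_univ] at h
  exact h.trans (mul_le_mul_of_nonneg_right hN (Finset.sum_nonneg fun _ _ => sq_nonneg _))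

/-- A round of weak learning succeeds with a probability of the order of its advantage. -/
theorem round_success_of_advantage {k : ℕ} (hloc : ∀ i, |bias P obs mean i| * √k ≤ 1) {N D : ℝ}
    (hN : (Fintype.card ι : ℝ) ≤ N) (hN0 : 0 < N) (hD : D = ∑ i, |bias P obs mean i|)
    (hD0 : 0 < D) :
    3 / 32 * √k * D / N ≤ (roundLaw k P mean).real
      {ω | 3 / 32 * √k * D ^ 2 / N ≤ corr P obs mean (roundSign obs ω)} := by
  have h1 := integral_corr_roundSign_ge P hobs k hloc
  have h2 := sq_sum_abs_bias_le P (obs := obs) (mean := mean) hN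
  rw [← hD] at h2
  have h3 : 2 * (3 / 32 * √k * D ^ 2 / N) ≤ 3 / 16 * √k * ∑ i, bias P obs mean i ^ 2 := by
    rw [mul_div_assoc', div_le_iff₀ hN0]
    have := mul_le_mul_of_nonneg_left h2 (by positivity : (0 : ℝ) ≤ 3 / 16 * √k)
    linarith
  have h4 := reverse_markov (roundLaw k P mean) (fun ω => corr P obs mean (roundSign obs ω))
    (D := D) (t := 3 / 32 * √k * D ^ 2 / N) (fun ω => by
      rw [hD]
      refine Finset.sum_le_sum fun i _ => (le_abs_self _).trans ?_
      rw [abs_mul, abs_roundSign, mul_one]) hD0 (by positivity) (h3.trans h1)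
  refine le_trans (le_of_eq ?_) h4
  field_simp

/-- The variance of the correlation learnt from one sample: the simulated spins and the coins
contribute independent terms, the sample a linear combination of the observables. -/
theorem variance_sum_recentredSpin_le {W : ℝ}
    (hW : ∀ a : ι → ℝ, variance (fun x => ∑ i, a i * obs i x) P ≤ W * ∑ i, a i ^ 2) (a : ι → ℝ) :
    variance (fun c => ∑ i, a i * recentredSpin obs i c) (cellLaw P mean)
      ≤ (2 + W / 2) * ∑ i, a i ^ 2 := by
  set e := ∑ i, a i * ((∫ x, obs i x ∂P - mean i) / 2) with he
  set ν := Measure.pi fun i : ι => (rademacher (1 / 2 + mean i / 2)).prod (rademacher (1 / 2))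
    with hν
  rw [← variance_sub_const (measurable_of_countable _).aestronglyMeasurable e]
  refine (variance_le_expectation_sq (measurable_of_countable _).aestronglyMeasurable).trans ?_
  set A : Ω × (ι → Bool × Bool) → ℝ := fun c =>
    ∑ i, a i * recentredSpin obs i c - ∑ i, a i * ((obs i c.1 - mean i) / 2) with hA
  set B : Ω → ℝ := fun x => ∑ i, a i * obs i x - ∫ y, ∑ i, a i * obs i y ∂P with hB
  have hsplit : ∀ c : Ω × (ι → Bool × Bool),
      (∑ i, a i * recentredSpin obs i c - e) ^ 2 ≤ 2 * A c ^ 2 + B c.1 ^ 2 / 2 := by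
    intro c
    have : ∑ i, a i * recentredSpin obs i c - e = A c + B c.1 / 2 := by
      simp only [hA, hB, he]
      rw [integral_finsetSum _ (fun _ _ => Integrable.of_finite)]
      simp only [integral_const_mul, mul_div_assoc', mul_sub, ← Finset.sum_div,
        Finset.sum_sub_distrib]
      ring
    rw [this]
    nlinarith [sq_nonneg (A c - B c.1 / 2)]
  have hinA : ∀ x : Ω, ∫ s, A (x, s) ^ 2 ∂ν ≤ ∑ i, a i ^ 2 := by
    intro x
    have hvar := variance_sum_pi
      (μ := fun i : ι => (rademacher (1 / 2 + mean i / 2)).prod (rademacher (1 / 2)))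
      (X := fun i z => a i * recentre (obs i x) z.1 z.2) (fun _ => MemLp.of_discrete)
    have hmeanA : ∫ s, (∑ i, fun s : ι → Bool × Bool =>
        a i * recentre (obs i x) (s i).1 (s i).2) s ∂ν = ∑ i, a i * ((obs i x - mean i) / 2) := by
      simp only [Finset.sum_apply]
      rw [integral_finsetSum _ (fun _ _ => Integrable.of_finite)]
      refine Finset.sum_congr rfl fun i _ => ?_
      rw [integral_const_mul]
      congr 1
      exact integral_seed_recentre hobs x i
    rw [variance_eq_integral (measurable_of_countable _).aemeasurable, hmeanA] at hvar
    have hL : ∫ s, A (x, s) ^ 2 ∂ν = ∑ i, variance (fun z : Bool × Bool =>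
        a i * recentre (obs i x) z.1 z.2)
        ((rademacher (1 / 2 + mean i / 2)).prod (rademacher (1 / 2))) := by
      rw [← hvar]
      refine integral_congr_ae (Filter.Eventually.of_forall fun s => ?_)
      simp [hA, recentredSpin]
    rw [hL]
    refine Finset.sum_le_sum fun i _ => ?_
    refine (variance_le_expectation_sq (measurable_of_countable _).aestronglyMeasurable).trans ?_
    have : ∀ z : Bool × Bool, ((fun z : Bool × Bool => a i * recentre (obs i x) z.1 z.2) ^ 2) z
        = a i ^ 2 := by
      intro z
      rw [Pi.pow_apply, mul_pow, ← sq_abs (recentre _ _ _), abs_recentre (hobs i x)]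
      ring
    simp only [this, integral_const, probReal_univ, one_smul, le_refl]
  have hEA : ∫ c, A c ^ 2 ∂cellLaw P mean ≤ ∑ i, a i ^ 2 := by
    rw [cellLaw, integral_prod _ Integrable.of_finite]
    refine (integral_mono Integrable.of_finite (Integrable.of_finite (f := fun _ : Ω => ∑ i, a i ^ 2)) hinA).trans ?_
    simp
  have hEB : ∫ c, B c.1 ^ 2 ∂cellLaw P mean ≤ W * ∑ i, a i ^ 2 := by
    rw [cellLaw, integral_prod _ Integrable.of_finite]
    refine le_trans (le_of_eq ?_) (hW a)
    rw [variance_eq_integral (measurable_of_countable _).aemeasurable]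
    simp only [hB, integral_const, probReal_univ, one_smul]
  have hfin : ∫ c, (2 * A c ^ 2 + B c.1 ^ 2 / 2) ∂cellLaw P mean
      ≤ (2 + W / 2) * ∑ i, a i ^ 2 := by
    rw [integral_add Integrable.of_finite Integrable.of_finite, integral_const_mul, integral_div]
    linarith
  exact (integral_mono Integrable.of_finite Integrable.of_finite hsplit).trans hfin

/-- A round that learns from one sample succeeds with probability close to one if the biases are
large. -/
theorem round_success_of_variance (hloc : ∀ i, |bias P obs mean i| ≤ 1) {W N D : ℝ}
    (hW0 : 0 ≤ W)
    (hW : ∀ a : ι → ℝ, variance (fun x => ∑ i, a i * obs i x) P ≤ W * ∑ i, a i ^ 2)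
    (hN : (Fintype.card ι : ℝ) ≤ N) (hN0 : 0 < N) (hD : D = ∑ i, |bias P obs mean i|)
    (hD0 : 0 < D) (hlarge : (456 + 114 * W) * N ≤ D ^ 2) :
    1 / 2 ≤ (roundLaw 1 P mean).real
      {ω | 3 / 32 * √(1 : ℕ) * D ^ 2 / N ≤ corr P obs mean (roundSign obs ω)} := by
  have h1 := integral_corr_roundSign_ge P hobs 1 (by simpa using hloc)
  have h2 := sq_sum_abs_bias_le P (obs := obs) (mean := mean) hN
  rw [← hD] at h2
  simp only [Nat.cast_one, Real.sqrt_one, mul_one] at h1 ⊢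
  set S := ∑ i, bias P obs mean i ^ 2 with hS
  set τ : Ω × (ι → Bool × Bool) → ℝ := fun c => ∑ i, bias P obs mean i * recentredSpin obs i c
    with hτ
  have hT : ∀ ω : RoundSpace 1 ι Ω, corr P obs mean (roundSign obs ω) = τ (ω.1 0) := by
    intro ω
    refine Finset.sum_congr rfl fun i _ => ?_
    congr 1
    have h : |recentredSpin obs i (ω.1 0)| = 1 := abs_recentre (hobs i _) _ _
    unfold roundSign
    rw [Fin.sum_univ_one]
    rcases (abs_eq zero_le_one).1 h with h | h <;> norm_num [h]
  have hmp : MeasurePreserving (fun ω : RoundSpace 1 ι Ω => ω.1 0) (roundLaw 1 P mean)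
      (cellLaw P mean) :=
    (measurePreserving_eval (fun _ : Fin 1 => cellLaw P mean) 0).comp measurePreserving_fst
  have hint : ∫ ω, corr P obs mean (roundSign obs ω) ∂roundLaw 1 P mean
      = ∫ c, τ c ∂cellLaw P mean := by
    simp only [hT]
    rw [← hmp.map_eq, integral_map hmp.measurable.aemeasurable
      (measurable_of_countable _).aestronglyMeasurable]
  rw [hint] at h1
  have hS0 : 0 < S := by
    by_contra hcon
    have : D ^ 2 ≤ 0 := h2.trans (mul_nonpos_of_nonneg_of_nonpos hN0.le (not_lt.1 hcon))
    exact absurd this (not_le.2 (pow_pos hD0 2))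
  have hcheb := real_meas_ge_le_variance_div_sq (cellLaw P mean) τ
    (s := 3 / 32 * S) (by positivity)
  have hbad : variance τ (cellLaw P mean) / (3 / 32 * S) ^ 2 ≤ 1 / 2 := by
    have h3 := variance_sum_recentredSpin_le P hobs (mean := mean) hW (bias P obs mean)
    rw [div_le_iff₀ (by positivity)]
    refine h3.trans ?_
    have h4 : 456 + 114 * W ≤ S := by
      have := hlarge.trans h2
      rw [mul_comm] at this
      exact le_of_mul_le_mul_left this hN0
    rw [← hS]
    nlinarith
  have hset : (cellLaw P mean).real {c | 3 / 32 * D ^ 2 / N ≤ τ c}ᶜ ≤ 1 / 2 := by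
    refine (measureReal_mono fun c hc => ?_).trans (hcheb.trans hbad)
    have hc' : τ c < 3 / 32 * D ^ 2 / N := not_le.1 hc
    change 3 / 32 * S ≤ |τ c - ∫ y, τ y ∂cellLaw P mean|
    have h5 : 3 / 32 * D ^ 2 / N ≤ 3 / 32 * S := by
      rw [div_le_iff₀ hN0]; linarith
    rw [abs_sub_comm]
    refine le_trans ?_ (le_abs_self _)
    linarith
  have hpre : {ω : RoundSpace 1 ι Ω | 3 / 32 * D ^ 2 / N ≤ corr P obs mean (roundSign obs ω)}
      = (fun ω : RoundSpace 1 ι Ω => ω.1 0) ⁻¹' {c | 3 / 32 * D ^ 2 / N ≤ τ c} := by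
    ext ω
    simp only [Set.mem_ofPred_eq, Set.mem_preimage, hT]
  rw [hpre, measureReal_def, hmp.measure_preimage (Set.toFinite _).measurableSet.nullMeasurableSet,
    ← measureReal_def]
  rw [probReal_compl_eq_one_sub (Set.toFinite _).measurableSet] at hset
  linarith

end Rounds

/-! ### Completeness and soundness of a stage -/

section Stage

theorem real_preimage_of_measurePreserving {α β : Type} [MeasurableSpace α] [MeasurableSpace β]
    [Finite β] [MeasurableSingletonClass β] {μ : Measure α} {ν : Measure β} {f : α → β}
    (hf : MeasurePreserving f μ ν) (Q : β → Prop) : μ.real {a | Q (f a)} = ν.real {b | Q b} := by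
  change μ.real (f ⁻¹' {b | Q b}) = _
  rw [measureReal_def, hf.measure_preimage (Set.toFinite _).measurableSet.nullMeasurableSet,
    measureReal_def]

variable {ι Ω : Type} [Fintype ι]

/-- The samples of a stage and its internal randomness, regrouped by the three steps. -/
abbrev SplitSpace (s : StageParams) (ι Ω : Type) : Type :=
  (Fin s.locSamples → Ω) × (Fin s.rounds → RoundSpace s.learnSamples ι Ω)
    × (Fin s.reps → Fin s.testSamples → Ω)

/-- Regrouping the samples and the internal randomness of a stage by the three steps. -/
def splitEquiv (s : StageParams) (ι Ω : Type) :
    ((s.SampleIdx → Ω) × s.Seed ι) ≃ SplitSpace s ι Ω where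
  toFun z := (fun j => z.1 (Sum.inl j),
    fun l => (fun j => (z.1 (Sum.inr (Sum.inl (l, j))),
      fun i => (z.2.1.1 ((l, j), i), z.2.1.2 ((l, j), i))), fun i => z.2.2 (l, i)),
    fun t j => z.1 (Sum.inr (Sum.inr (t, j))))
  invFun y := (Sum.elim y.1 (Sum.elim (fun a => ((y.2.1 a.1).1 a.2).1) (fun a => y.2.2 a.1 a.2)),
    ((fun a => (((y.2.1 a.1.1).1 a.1.2).2 a.2).1, fun a => (((y.2.1 a.1.1).1 a.1.2).2 a.2).2),
      fun a => (y.2.1 a.1).2 a.2))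
  left_inv := by
    rintro ⟨x, r⟩
    refine Prod.ext ?_ rfl
    funext a
    rcases a with a | a | a <;> rfl
  right_inv _ := rfl

omit [Fintype ι] in
theorem splitEquiv_symm_apply (s : StageParams) (y : SplitSpace s ι Ω) :
    (splitEquiv s ι Ω).symm y
      = (Sum.elim y.1 (Sum.elim (fun a => ((y.2.1 a.1).1 a.2).1) (fun a => y.2.2 a.1 a.2)),
        ((fun a => (((y.2.1 a.1.1).1 a.1.2).2 a.2).1, fun a => (((y.2.1 a.1.1).1 a.1.2).2 a.2).2),
          fun a => (y.2.1 a.1).2 a.2)) := rfl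

variable [MeasurableSpace Ω] (P : Measure Ω)

/-- The joint law of the samples and the internal randomness of a stage. -/
def stageLaw (s : StageParams) (mean : ι → ℝ) : Measure ((s.SampleIdx → Ω) × s.Seed ι) :=
  (Measure.pi fun _ => P).prod (s.seedLaw mean)

/-- The law of the regrouped data of a stage. -/
def splitLaw (s : StageParams) (mean : ι → ℝ) : Measure (SplitSpace s ι Ω) :=
  (Measure.pi fun _ => P).prod ((Measure.pi fun _ => roundLaw s.learnSamples P mean).prod
    (Measure.pi fun _ => Measure.pi fun _ => P))

/-- The statistic of one batch. -/
def batchStatistic {m : ℕ} (obs : ι → Ω → ℝ) (mean Γ : ι → ℝ) (c : Fin m → Ω) : ℝ :=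
  (∑ j, ∑ i, Γ i * (obs i (c j) - mean i)) / m

open Classical in
/-- More than half of the batches exceed the threshold. -/
def MajorityExceeds {R m : ℕ} (obs : ι → Ω → ℝ) (mean : ι → ℝ) (thr : ℝ) (Γ : ι → ℝ)
    (c : Fin R → Fin m → Ω) : Prop :=
  R < 2 * (Finset.univ.filter fun t => thr < batchStatistic obs mean Γ (c t)).card

/-- The localization step rejects. -/
def LocRejects {M : ℕ} (obs : ι → Ω → ℝ) (mean : ι → ℝ) (τ : ℝ) (a : Fin M → Ω) : Prop :=
  ∃ i, τ ≤ |(∑ j, obs i (a j)) / M - mean i|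

variable [Fintype Ω] [MeasurableSingletonClass Ω] [IsProbabilityMeasure P]
  {obs : ι → Ω → ℝ} {mean : ι → ℝ} [hmean : Fact (∀ i, |mean i| ≤ 1)]

instance isProbabilityMeasure_seedLaw (s : StageParams) :
    IsProbabilityMeasure (s.seedLaw mean) := by
  unfold StageParams.seedLaw; infer_instance

instance isProbabilityMeasure_stageLaw (s : StageParams) :
    IsProbabilityMeasure (stageLaw P s mean) := by
  unfold stageLaw; infer_instance

instance isProbabilityMeasure_splitLaw (s : StageParams) :
    IsProbabilityMeasure (splitLaw P s mean) := by
  unfold splitLaw; infer_instance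

theorem measurePreserving_splitEquiv (s : StageParams) :
    MeasurePreserving (splitEquiv s ι Ω) (stageLaw P s mean) (splitLaw P s mean) := by
  refine measurePreserving_of_singleton _ fun y => ?_
  obtain ⟨a, b, c⟩ := y
  rw [splitEquiv_symm_apply]
  simp only [stageLaw, splitLaw, StageParams.seedLaw, roundLaw, cellLaw, prod_singleton_eq_mul,
    Measure.pi_singleton, Fintype.prod_sum_type, Fintype.prod_prod_type,
    Sum.elim_inl, Sum.elim_inr, Finset.prod_mul_distrib]
  ring

theorem splitLaw_loc (s : StageParams) (Q : (Fin s.locSamples → Ω) → Prop) :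
    (splitLaw P s mean).real {y | Q y.1} = (Measure.pi fun _ => P).real {a | Q a} :=
  real_preimage_of_measurePreserving measurePreserving_fst Q

omit hmean in
theorem splitLaw_rounds (s : StageParams)
    (Q : (Fin s.rounds → RoundSpace s.learnSamples ι Ω) → Prop) :
    (splitLaw P s mean).real {y | Q y.2.1}
      = (Measure.pi fun _ => roundLaw s.learnSamples P mean).real {b | Q b} :=
  real_preimage_of_measurePreserving (measurePreserving_fst.comp measurePreserving_snd) Q

/-- Conditioning on the rounds of weak learning, which are independent of the test samples. -/
theorem splitLaw_test_le (s : StageParams) {r : ℝ}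
    (Q : (Fin s.rounds → RoundSpace s.learnSamples ι Ω) → (Fin s.reps → Fin s.testSamples → Ω)
      → Prop)
    (h : ∀ b, (Measure.pi fun _ : Fin s.reps => Measure.pi fun _ : Fin s.testSamples => P).real
      {c | Q b c} ≤ r) :
    (splitLaw P s mean).real {y | Q y.2.1 y.2.2} ≤ r :=
  (real_preimage_of_measurePreserving measurePreserving_snd
    fun z : (Fin s.rounds → RoundSpace s.learnSamples ι Ω) × (Fin s.reps → Fin s.testSamples → Ω) =>
      Q z.1 z.2).trans_le
    (prod_real_le_of_section _ _ (fun b => {c | Q b c}) h)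

/-- The probability that a stage rejects, in terms of the regrouped data: `splitEquiv` is chosen so
that the three steps unfold to their descriptions on the three factors. -/
theorem stageLaw_rejects (s : StageParams) :
    (stageLaw P s mean).real {z | s.Rejects obs mean z.1 z.2}
      = (splitLaw P s mean).real {y | LocRejects obs mean s.locTol y.1 ∨
        ∃ l, MajorityExceeds obs mean s.testThreshold (roundSign obs (y.2.1 l)) y.2.2} :=
  real_preimage_of_measurePreserving (measurePreserving_splitEquiv P s)
    (fun y => LocRejects obs mean s.locTol y.1 ∨
        ∃ l, MajorityExceeds obs mean s.testThreshold (roundSign obs (y.2.1 l)) y.2.2)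

omit hmean in
/-- The batch statistic of a sign vector concentrates around its correlation with the biases. -/
theorem batchStatistic_deviation_le {Γ : ι → ℝ} {m : ℕ} (hm : 0 < m) {V thr : ℝ}
    (hV : variance (fun x => ∑ i, Γ i * obs i x) P ≤ V) (hthr : 0 < thr) :
    (Measure.pi fun _ : Fin m => P).real
      {c | thr ≤ |batchStatistic obs mean Γ c - corr P obs mean Γ|} ≤ V / (m * thr ^ 2) := by
  have e : ∀ x, ∑ i, Γ i * (obs i x - mean i) = ∑ i, Γ i * obs i x - ∑ i, Γ i * mean i := by
    intro x; simp only [mul_sub, Finset.sum_sub_distrib]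
  have hvar : variance (fun x => ∑ i, Γ i * (obs i x - mean i)) P ≤ V := by
    simp only [e]
    rwa [variance_sub_const (measurable_of_countable _).aestronglyMeasurable]
  have hcorr : ∫ x, ∑ i, Γ i * (obs i x - mean i) ∂P = corr P obs mean Γ := by
    rw [integral_finsetSum _ (fun _ _ => Integrable.of_finite)]
    refine Finset.sum_congr rfl fun i _ => ?_
    rw [integral_const_mul, integral_sub Integrable.of_finite Integrable.of_finite, bias]
    simp
    ring
  have h := average_deviation_le_variance P _ hm hvar hthr
  rw [hcorr] at h
  exact h

omit hmean in
/-- A sign vector without correlation is rejected with small probability. -/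
theorem majorityExceeds_le {Γ : ι → ℝ} {R m : ℕ} (hm : 0 < m) {V thr : ℝ}
    (hV : variance (fun x => ∑ i, Γ i * obs i x) P ≤ V) (hthr : 0 < thr)
    (hsmall : V / (m * thr ^ 2) ≤ 1 / 16) (hΓ : corr P obs mean Γ = 0) :
    (Measure.pi fun _ : Fin R => Measure.pi fun _ : Fin m => P).real
      {c | MajorityExceeds obs mean thr Γ c} ≤ (1 / 2) ^ R := by
  have h1 : (Measure.pi fun _ : Fin m => P).real {c | thr < batchStatistic obs mean Γ c}
      ≤ 1 / 16 := by
    refine (measureReal_mono fun c hc => ?_).trans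
      ((batchStatistic_deviation_le P (mean := mean) hm hV hthr).trans hsmall)
    have hc' : thr < batchStatistic obs mean Γ c := hc
    change thr ≤ |_|
    rw [hΓ, sub_zero]
    exact hc'.le.trans (le_abs_self _)
  refine (measureReal_mono fun c hc => ?_).trans (half_of_trials_le _ _ h1 R)
  exact le_of_lt (show R < _ from hc)

omit hmean in
/-- A sign vector with a large correlation is accepted with small probability. -/
theorem not_majorityExceeds_le {Γ : ι → ℝ} {R m : ℕ} (hm : 0 < m) {V thr : ℝ}
    (hV : variance (fun x => ∑ i, Γ i * obs i x) P ≤ V) (hthr : 0 < thr)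
    (hsmall : V / (m * thr ^ 2) ≤ 1 / 16) (hΓ : 2 * thr ≤ corr P obs mean Γ) :
    (Measure.pi fun _ : Fin R => Measure.pi fun _ : Fin m => P).real
      {c | ¬ MajorityExceeds obs mean thr Γ c} ≤ (1 / 2) ^ R := by
  have h1 : (Measure.pi fun _ : Fin m => P).real {c | ¬ thr < batchStatistic obs mean Γ c}
      ≤ 1 / 16 := by
    refine (measureReal_mono fun c hc => ?_).trans
      ((batchStatistic_deviation_le P (mean := mean) hm hV hthr).trans hsmall)
    have hc' : ¬ thr < batchStatistic obs mean Γ c := hc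
    change thr ≤ |_|
    rw [abs_sub_comm]
    exact le_trans (by linarith) (le_abs_self _)
  refine (measureReal_mono fun c hc => ?_).trans (half_of_trials_le _ _ h1 R)
  have hc' := not_lt.1 (show ¬ R < _ from hc)
  have hsum := Finset.card_filter_add_card_filter_not (s := (Finset.univ : Finset (Fin R)))
    (fun t => thr < batchStatistic obs mean Γ (c t))
  rw [Finset.card_univ, Fintype.card_fin] at hsum
  have hhalf : R ≤ 2 * (Finset.univ.filter fun t => ¬ thr < batchStatistic obs mean Γ (c t)).card := by
    omega
  rw [Set.mem_ofPred_eq]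
  convert hhalf

/-- **Completeness of a stage**: if the means agree, it rejects with probability at most `1 / 20`. -/
theorem stage_rejects_le (s : StageParams) (hobs : ∀ i x, |obs i x| = 1)
    (hbias : ∀ i, ∫ x, obs i x ∂P = mean i) (hM : 0 < s.locSamples) (hτ : 0 ≤ s.locTol)
    (hloc : Fintype.card ι * (2 * Real.exp (-(s.locSamples * s.locTol ^ 2 / 2))) ≤ 1 / 40)
    (hm : 0 < s.testSamples) (hthr : 0 < s.testThreshold) {V : ℝ}
    (hV : ∀ Γ : ι → ℝ, (∀ i, |Γ i| = 1) → variance (fun x => ∑ i, Γ i * obs i x) P ≤ V)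
    (hsmall : V / (s.testSamples * s.testThreshold ^ 2) ≤ 1 / 16)
    (hR : s.rounds * (1 / 2 : ℝ) ^ s.reps ≤ 1 / 40) :
    (stageLaw P s mean).real {z | s.Rejects obs mean z.1 z.2} ≤ 1 / 20 := by
  rw [stageLaw_rejects]
  have h1 : (splitLaw P s mean).real {y | LocRejects obs mean s.locTol y.1} ≤ 1 / 40 := by
    refine (splitLaw_loc P s fun a => LocRejects obs mean s.locTol a).trans_le (le_trans ?_ hloc)
    have : {a : Fin s.locSamples → Ω | LocRejects obs mean s.locTol a}
        = ⋃ i, {a | s.locTol ≤ |(∑ j, obs i (a j)) / s.locSamples - ∫ y, obs i y ∂P|} := by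
      ext a; simp only [hbias, Set.mem_iUnion]; rfl
    rw [this]
    refine (measureReal_iUnion_fintype_le _).trans ((Finset.sum_le_sum fun i _ =>
      average_deviation_le_exp P (obs i) (fun x => (hobs i x).le) hM hτ).trans (le_of_eq ?_))
    simp
  have hcorr : ∀ Γ, corr P obs mean Γ = 0 := fun Γ =>
    Finset.sum_eq_zero fun i _ => by rw [bias, hbias, sub_self, zero_mul]
  have h2 : (splitLaw P s mean).real {y | ∃ l, MajorityExceeds obs mean s.testThreshold
      (roundSign obs (y.2.1 l)) y.2.2} ≤ 1 / 40 := by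
    refine le_trans (splitLaw_test_le P s (fun b c => ∃ l, MajorityExceeds obs mean
      s.testThreshold (roundSign obs (b l)) c) fun b => ?_) hR
    have : {c : Fin s.reps → Fin s.testSamples → Ω | ∃ l, MajorityExceeds obs mean
        s.testThreshold (roundSign obs (b l)) c}
        = ⋃ l, {c | MajorityExceeds obs mean s.testThreshold (roundSign obs (b l)) c} := by
      ext c; simp
    rw [this]
    refine (measureReal_iUnion_fintype_le _).trans ((Finset.sum_le_sum fun l _ =>
      majorityExceeds_le P hm (hV _ fun i => abs_roundSign (b l) i) hthr hsmall
        (hcorr _)).trans (le_of_eq ?_))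
    simp
  refine (measureReal_union_le {y : SplitSpace s ι Ω | LocRejects obs mean s.locTol y.1}
    {y | ∃ l, MajorityExceeds obs mean s.testThreshold (roundSign obs (y.2.1 l)) y.2.2}).trans ?_
  linarith

theorem stageLaw_not_rejects (s : StageParams) :
    (stageLaw P s mean).real {z | ¬ s.Rejects obs mean z.1 z.2}
      = (splitLaw P s mean).real {y | ¬ (LocRejects obs mean s.locTol y.1 ∨
        ∃ l, MajorityExceeds obs mean s.testThreshold (roundSign obs (y.2.1 l)) y.2.2)} :=
  real_preimage_of_measurePreserving (measurePreserving_splitEquiv P s)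
    (fun y => ¬ (LocRejects obs mean s.locTol y.1 ∨
        ∃ l, MajorityExceeds obs mean s.testThreshold (roundSign obs (y.2.1 l)) y.2.2))

/-- Localization finds an observable of large bias. -/
theorem stage_not_rejects_le_of_bias (s : StageParams) (hobs : ∀ i x, |obs i x| = 1) {i : ι}
    (hbias : 2 * s.locTol ≤ |bias P obs mean i|) (hM : 0 < s.locSamples) (hτ : 0 < s.locTol)
    (hloc : 2 * Real.exp (-(s.locSamples * s.locTol ^ 2 / 2)) ≤ 1 / 10) :
    (stageLaw P s mean).real {z | ¬ s.Rejects obs mean z.1 z.2} ≤ 1 / 10 := by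
  rw [stageLaw_not_rejects]
  refine (measureReal_mono (s₂ := {y : SplitSpace s ι Ω | s.locTol ≤
    |(∑ j, obs i (y.1 j)) / s.locSamples - ∫ y, obs i y ∂P|}) fun y hy => ?_).trans ?_
  · have hy' : ¬ (LocRejects obs mean s.locTol y.1 ∨ _) := hy
    rw [not_or] at hy'
    have h1 : |(∑ j, obs i (y.1 j)) / s.locSamples - mean i| < s.locTol :=
      not_le.1 fun h => hy'.1 ⟨i, h⟩
    change s.locTol ≤ |_|
    have h2 : |bias P obs mean i| ≤ |(∑ j, obs i (y.1 j)) / s.locSamples - mean i|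
        + |(∑ j, obs i (y.1 j)) / s.locSamples - ∫ y, obs i y ∂P| := by
      rw [bias]
      refine le_trans (le_of_eq ?_) (abs_sub _ _)
      congr 1
      ring
    linarith
  · refine (splitLaw_loc P s fun a =>
      s.locTol ≤ |(∑ j, obs i (a j)) / s.locSamples - ∫ y, obs i y ∂P|).trans_le ?_
    exact (average_deviation_le_exp P (obs i) (fun x => (hobs i x).le) hM hτ.le).trans hloc

/-- If each round of weak learning succeeds with probability at least `π`, then one of the learnt
sign vectors is rejected. -/
theorem stage_not_rejects_le_of_rounds (s : StageParams) (hm : 0 < s.testSamples)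
    (hthr : 0 < s.testThreshold) {V : ℝ}
    (hV : ∀ Γ : ι → ℝ, (∀ i, |Γ i| = 1) → variance (fun x => ∑ i, Γ i * obs i x) P ≤ V)
    (hsmall : V / (s.testSamples * s.testThreshold ^ 2) ≤ 1 / 16)
    {π : ℝ} (hround : π ≤ (roundLaw s.learnSamples P mean).real
      {ω | 2 * s.testThreshold ≤ corr P obs mean (roundSign obs ω)})
    (hL : Real.exp (-(π * s.rounds)) ≤ 1 / 20) (hR : (1 / 2 : ℝ) ^ s.reps ≤ 1 / 40) :
    (stageLaw P s mean).real {z | ¬ s.Rejects obs mean z.1 z.2} ≤ 1 / 10 := by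
  set good : Set (RoundSpace s.learnSamples ι Ω) :=
    {ω | 2 * s.testThreshold ≤ corr P obs mean (roundSign obs ω)} with hgood
  rw [stageLaw_not_rejects]
  have hmono : (splitLaw P s mean).real {y | ¬ (LocRejects obs mean s.locTol y.1 ∨
      ∃ l, MajorityExceeds obs mean s.testThreshold (roundSign obs (y.2.1 l)) y.2.2)}
      ≤ (splitLaw P s mean).real ({y | ∀ l, y.2.1 l ∈ goodᶜ} ∪ {y | ∃ l, y.2.1 l ∈ good ∧
        ∀ l, ¬ MajorityExceeds obs mean s.testThreshold (roundSign obs (y.2.1 l)) y.2.2}) := by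
    refine measureReal_mono fun y hy => ?_
    have hy' : ¬ (LocRejects obs mean s.locTol y.1 ∨
      ∃ l, MajorityExceeds obs mean s.testThreshold (roundSign obs (y.2.1 l)) y.2.2) := hy
    rw [not_or, not_exists] at hy'
    by_cases h : ∃ l, y.2.1 l ∈ good
    · obtain ⟨l, hl⟩ := h
      exact Or.inr ⟨l, hl, hy'.2⟩
    · exact Or.inl fun l hl => h ⟨l, hl⟩
  have h1 : (splitLaw P s mean).real {y | ∀ l, y.2.1 l ∈ goodᶜ} ≤ 1 / 20 := by
    refine (splitLaw_rounds P s fun b => ∀ l, b l ∈ goodᶜ).trans_le ?_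
    rw [pi_real_forall_mem, probReal_compl_eq_one_sub (Set.toFinite _).measurableSet]
    have hle : (roundLaw s.learnSamples P mean).real good ≤ 1 := measureReal_le_one
    refine le_trans (pow_le_pow_left₀ (by linarith) (b := Real.exp (-π)) ?_ _) ?_
    · linarith [Real.add_one_le_exp (-π)]
    · rw [← Real.exp_nat_mul]
      refine le_trans (le_of_eq ?_) hL
      ring_nf
  have h2 : (splitLaw P s mean).real {y | ∃ l, y.2.1 l ∈ good ∧ ∀ l,
      ¬ MajorityExceeds obs mean s.testThreshold (roundSign obs (y.2.1 l)) y.2.2} ≤ 1 / 40 := by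
    refine splitLaw_test_le P s (fun b c => ∃ l, b l ∈ good ∧ ∀ l,
      ¬ MajorityExceeds obs mean s.testThreshold (roundSign obs (b l)) c) fun b => ?_
    by_cases h : ∃ l, b l ∈ good
    · obtain ⟨l, hl⟩ := h
      refine (measureReal_mono fun c hc => ?_).trans ((not_majorityExceeds_le P hm
        (hV _ fun i => abs_roundSign (b l) i) hthr hsmall hl).trans hR)
      obtain ⟨_, _, hc⟩ := hc
      exact hc l
    · have : {c : Fin s.reps → Fin s.testSamples → Ω | ∃ l, b l ∈ good ∧ ∀ l,
          ¬ MajorityExceeds obs mean s.testThreshold (roundSign obs (b l)) c} = ∅ := by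
        ext c
        simp only [Set.mem_empty_iff_false, iff_false]
        rintro ⟨l, hl, _⟩
        exact h ⟨l, hl⟩
      rw [this, measureReal_empty]
      norm_num
  refine hmono.trans ((measureReal_union_le _ _).trans ?_)
  linarith

end Stage

/-! ### The parameters of a stage -/

section Parameters

/-- The hypotheses on an unknown distribution under which a stage is analysed: at most `N`
observables with values `±1`, reference means in `[-1, 1]`, and linear combinations of the
observables with variance at most `W` times the squared norm of the coefficients. -/
structure StageInput {ι Ω : Type} [Fintype ι] [MeasurableSpace Ω] (P : Measure Ω)
    (obs : ι → Ω → ℝ) (mean : ι → ℝ) (N : ℕ) (W : ℝ) : Prop where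
  card_le : Fintype.card ι ≤ N
  abs_obs : ∀ i x, |obs i x| = 1
  abs_mean : ∀ i, |mean i| ≤ 1
  variance_le : ∀ a : ι → ℝ, variance (fun x => ∑ i, a i * obs i x) P ≤ W * ∑ i, a i ^ 2

/-- With `k` samples per round and `L` rounds, one of the rounds learns a sign vector of correlation
at least `2 · thr` with probability at least `19 / 20`, if the biases sum up to `1 / ρ` but are each
at most `1 / √k`. -/
def LearnsWith (k L : ℕ) (N : ℕ) (W ρ thr : ℝ) : Prop :=
  ∀ (ι Ω : Type) [Fintype ι] [Fintype Ω] [MeasurableSpace Ω] [MeasurableSingletonClass Ω]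
    (P : Measure Ω) [IsProbabilityMeasure P] (obs : ι → Ω → ℝ) (mean : ι → ℝ),
    StageInput P obs mean N W → (∀ i, |bias P obs mean i| * √k ≤ 1) →
    1 / ρ ≤ ∑ i, |bias P obs mean i| →
    ∃ r : ℝ, r ≤ (roundLaw k P mean).real {ω | 2 * thr ≤ corr P obs mean (roundSign obs ω)} ∧
      Real.exp (-(r * L)) ≤ 1 / 20

theorem exp_neg_three_le : Real.exp (-3) ≤ 1 / 20 := by
  have h := Real.exp_one_gt_d9
  have e : Real.exp 3 = Real.exp 1 ^ 3 := by rw [← Real.exp_nat_mul]; norm_num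
  have h3 : (20 : ℝ) ≤ Real.exp 3 := by
    rw [e]
    calc (20 : ℝ) ≤ 2.7182818283 ^ 3 := by norm_num
      _ ≤ _ := pow_le_pow_left₀ (by norm_num) h.le 3
  rw [Real.exp_neg, ← one_div]
  exact one_div_le_one_div_of_le (by norm_num) h3

theorem threshold_le {k N : ℕ} {ρ D : ℝ} (hN : 0 < N) (hρ : 0 < ρ) (hD : 1 / ρ ≤ D) :
    2 * (3 / 64 * √k / (N * ρ ^ 2)) ≤ 3 / 32 * √k * D ^ 2 / N := by
  have hN' : (0 : ℝ) < N := by exact_mod_cast hN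
  have h1 : (1 / ρ) ^ 2 ≤ D ^ 2 := pow_le_pow_left₀ (by positivity) hD 2
  have e : 2 * (3 / 64 * √k / (N * ρ ^ 2)) = 3 / 32 * √k * (1 / ρ) ^ 2 / N := by
    field_simp; ring
  rw [e]
  gcongr

/-- Many rounds of little advantage: `r ≳ √k / (ρ N)` is at least of order `1 / g` if `k` is of order
`(N ρ / g)²`, so that `64 g` rounds suffice. -/
theorem learnsWith_of_le {k L N : ℕ} {W ρ g : ℝ} (hN : 0 < N) (hρ : 0 < ρ) (hg : 0 < g)
    (hk : N ^ 2 * ρ ^ 2 / g ^ 2 ≤ k) (hL : 64 * g ≤ L) :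
    LearnsWith k L N W ρ (3 / 64 * √k / (N * ρ ^ 2)) := by
  intro ι Ω _ _ _ _ P _ obs mean hin hloc hfar
  have : Fact (∀ i, |mean i| ≤ 1) := ⟨hin.abs_mean⟩
  have hN' : (0 : ℝ) < N := by exact_mod_cast hN
  have hD0 : 0 < ∑ i, |bias P obs mean i| := lt_of_lt_of_le (by positivity) hfar
  have h := round_success_of_advantage P hin.abs_obs hloc (N := N) (by exact_mod_cast hin.card_le)
    hN' rfl hD0
  refine ⟨_, h.trans (measureReal_mono fun ω hω => (threshold_le hN hρ hfar).trans hω), ?_⟩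
  refine le_trans (Real.exp_le_exp.2 ?_) exp_neg_three_le
  have hsqrt : N * ρ / g ≤ √k := by
    apply Real.le_sqrt_of_sq_le
    rw [div_pow, mul_pow]; exact hk
  set D := ∑ i, |bias P obs mean i|
  have h1 : 3 / 32 * (N * ρ / g) * (1 / ρ) / N ≤ 3 / 32 * √k * D / N := by gcongr
  have e : 3 / 32 * (N * ρ / g) * (1 / ρ) / N = 3 / 32 / g := by field_simp
  rw [e] at h1
  have h2 : 3 / 32 / g * (64 * g) ≤ 3 / 32 * √k * D / N * L :=
    mul_le_mul h1 hL (by positivity) (by positivity)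
  have e2 : 3 / 32 / g * (64 * g) = 6 := by field_simp; norm_num
  linarith

/-- If the biases are so large that one sample per round is enough, the sign vectors concentrate, and
a constant number of rounds suffices. -/
theorem learnsWith_one {N n : ℕ} {η ρ g : ℝ} (hη : 0 < η) (hn : 0 < n) (hnN : n ≤ N) (hρ : 0 < ρ)
    (hg : 1 ≤ g) (hgn : g ^ 3 = n)
    (hq : 456 * (1 + 1 / η) * (N ^ 2 * ρ ^ 2 / g ^ 2) ≤ 1) :
    LearnsWith 1 8 N (4 / η * (N / n)) ρ (3 / 64 * √(1 : ℕ) / (N * ρ ^ 2)) := by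
  intro ι Ω _ _ _ _ P _ obs mean hin hloc hfar
  have : Fact (∀ i, |mean i| ≤ 1) := ⟨hin.abs_mean⟩
  have hn' : (0 : ℝ) < n := by exact_mod_cast hn
  have hnN' : (n : ℝ) ≤ N := by exact_mod_cast hnN
  have hN' : (0 : ℝ) < N := by linarith
  have hD0 : 0 < ∑ i, |bias P obs mean i| := lt_of_lt_of_le (by positivity) hfar
  have hlarge : (456 + 114 * (4 / η * (N / n))) * N ≤ (∑ i, |bias P obs mean i|) ^ 2 := by
    have h1 : (1 / ρ) ^ 2 ≤ (∑ i, |bias P obs mean i|) ^ 2 :=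
      pow_le_pow_left₀ (by positivity) hfar 2
    refine le_trans ?_ h1
    have h2 : (1 : ℝ) ≤ N / n := (one_le_div hn').2 hnN'
    have h3 : (456 + 114 * (4 / η * (N / n))) * N ≤ 456 * (1 + 1 / η) * (N / n) * N := by
      apply mul_le_mul_of_nonneg_right _ hN'.le
      have e : 456 * (1 + 1 / η) * ((N : ℝ) / n) = 456 * (N / n) + 114 * (4 / η * (N / n)) := by ring
      rw [e]; linarith
    refine h3.trans ?_
    rw [one_div ρ, inv_pow, ← one_div, le_div_iff₀ (by positivity)]
    refine le_trans ?_ hq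
    have e : 456 * (1 + 1 / η) * ((N : ℝ) / n) * N * ρ ^ 2
        = 456 * (1 + 1 / η) * (N ^ 2 * ρ ^ 2 / g ^ 2) / g := by
      rw [← hgn]; field_simp
    rw [e]
    exact div_le_self (by positivity) hg
  have h := round_success_of_variance P hin.abs_obs (by simpa using hloc) (by positivity)
    hin.variance_le (N := N) (by exact_mod_cast hin.card_le) hN' rfl hD0 hlarge
  refine ⟨1 / 2, h.trans (measureReal_mono fun ω hω =>
    (threshold_le (Nat.cast_pos.1 hN') hρ hfar).trans hω), ?_⟩
  refine le_trans (Real.exp_le_exp.2 ?_) exp_neg_three_le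
  norm_num

/-- The numbers of samples and of rounds of the weak learning step, in the two regimes
`k ≈ (N ρ / g)²` and `k = 1`. -/
theorem exists_learnsWith {N n : ℕ} {η ρ g : ℝ} (hη : 0 < η) (hn : 0 < n) (hnN : n ≤ N)
    (hρ : 0 < ρ) (hg : 1 ≤ g) (hgn : g ^ 3 = n) :
    ∃ k L : ℕ, 0 < k ∧ 0 < L ∧ (k : ℝ) ≤ 1 + N ^ 2 * ρ ^ 2 / g ∧ N ^ 2 * ρ ^ 2 / g ^ 2 ≤ k ∧
      (L : ℝ) ≤ 65 * g ∧
      (L * k : ℝ) ≤ 65 * (1 + 456 * (1 + 1 / η)) * (1 + N ^ 2 * ρ ^ 2 / g) ∧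
      LearnsWith k L N (4 / η * (N / n)) ρ (3 / 64 * √k / (N * ρ ^ 2)) := by
  have hN : 0 < N := hn.trans_le hnN
  have hN' : (0 : ℝ) < N := by exact_mod_cast hN
  have hg0 : 0 < g := by linarith
  -- The constant of `learnsWith_one`: below the scale `1 / K`, one sample per round is enough.
  set K : ℝ := 456 * (1 + 1 / η) with hK
  have hK1 : 1 ≤ K := by
    have : 0 < 1 / η := by positivity
    rw [hK]; linarith
  set q : ℝ := N ^ 2 * ρ ^ 2 / g ^ 2 with hq
  have hq0 : 0 < q := by positivity
  have hB : (N : ℝ) ^ 2 * ρ ^ 2 / g = q * g := by rw [hq]; field_simp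
  rw [hB]
  have hqB : q ≤ q * g := le_mul_of_one_le_right hq0.le hg
  by_cases hcase : K * q ≤ 1
  · refine ⟨1, 8, one_pos, by norm_num, ?_, ?_, ?_, ?_,
      learnsWith_one hη hn hnN hρ hg hgn hcase⟩
    · push_cast; linarith
    · push_cast; nlinarith
    · push_cast; linarith
    · push_cast; nlinarith [mul_pos hq0 hg0]
  · have hcase' : 1 < K * q := not_le.1 hcase
    have hceil : (⌈q⌉₊ : ℝ) ≤ q + 1 := (Nat.ceil_lt_add_one hq0.le).le
    have hceilL : (⌈64 * g⌉₊ : ℝ) ≤ 65 * g := by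
      have := (Nat.ceil_lt_add_one (by positivity : 0 ≤ 64 * g)).le
      linarith
    refine ⟨⌈q⌉₊, ⌈64 * g⌉₊, Nat.ceil_pos.2 hq0, Nat.ceil_pos.2 (by positivity), by linarith,
      Nat.le_ceil _, hceilL, ?_, learnsWith_of_le hN hρ hg0 (Nat.le_ceil _) (Nat.le_ceil _)⟩
    calc (⌈64 * g⌉₊ * ⌈q⌉₊ : ℝ) ≤ 65 * g * ((1 + K) * q) :=
          mul_le_mul hceilL (by linarith) (by positivity) (by positivity)
      _ = 65 * (1 + K) * (q * g) := by ring
      _ ≤ 65 * (1 + K) * (1 + q * g) :=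
          mul_le_mul_of_nonneg_left (by linarith) (by positivity)

theorem one_le_log_add_two {n : ℕ} (hn : 0 < n) : 1 ≤ Real.log ((n : ℝ) + 2) := by
  have hn1 : (1 : ℝ) ≤ n := by exact_mod_cast hn
  rw [Real.le_log_iff_exp_le (by linarith)]
  linarith [Real.exp_one_lt_d9]

theorem exp_neg_mul_log_add_two (n t : ℕ) :
    Real.exp (-(t * Real.log ((n : ℝ) + 2))) = (((n : ℝ) + 2) ^ t)⁻¹ := by
  have h : (0 : ℝ) < (n : ℝ) + 2 := by positivity
  rw [Real.exp_neg, Real.exp_nat_mul, Real.exp_log h]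

/-- Localization with `48 log (n + 2) · k` samples has the accuracy `1 / (2 √k)`, uniformly in `n²`
observables. -/
theorem mul_exp_locSamples_le {N n k : ℕ} (hn : 0 < n) (hNn : N ≤ n ^ 2) (hk : 0 < k) :
    N * (2 * Real.exp (-((⌈48 * Real.log ((n : ℝ) + 2)⌉₊ * k : ℕ) * (1 / (2 * √(k : ℝ))) ^ 2 / 2)))
      ≤ 1 / 40 := by
  have hn' : (0 : ℝ) < n := by exact_mod_cast hn
  have hn1 : (1 : ℝ) ≤ n := by exact_mod_cast hn
  have hNn' : (N : ℝ) ≤ n ^ 2 := by exact_mod_cast hNn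
  have hk' : (0 : ℝ) < k := by exact_mod_cast hk
  have e : ((⌈48 * Real.log ((n : ℝ) + 2)⌉₊ * k : ℕ) : ℝ) * (1 / (2 * √(k : ℝ))) ^ 2 / 2
      = ⌈48 * Real.log ((n : ℝ) + 2)⌉₊ / 8 := by
    rw [div_pow, mul_pow, Real.sq_sqrt hk'.le]
    push_cast
    field_simp
    ring
  have hexp : Real.exp (-(⌈48 * Real.log ((n : ℝ) + 2)⌉₊ / 8 : ℝ)) ≤ (((n : ℝ) + 2) ^ 6)⁻¹ := by
    rw [← exp_neg_mul_log_add_two]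
    apply Real.exp_le_exp.2
    have := Nat.le_ceil (48 * Real.log ((n : ℝ) + 2))
    push_cast
    linarith
  have h1 : (81 : ℝ) * n ^ 2 ≤ ((n : ℝ) + 2) ^ 6 := by
    calc (81 : ℝ) * n ^ 2 = 3 ^ 4 * n ^ 2 := by norm_num
      _ ≤ ((n : ℝ) + 2) ^ 4 * ((n : ℝ) + 2) ^ 2 := by
        gcongr <;> linarith
      _ = _ := by ring
  rw [e]
  calc (N : ℝ) * (2 * Real.exp (-(⌈48 * Real.log ((n : ℝ) + 2)⌉₊ / 8 : ℝ)))
      ≤ n ^ 2 * (2 * (81 * (n : ℝ) ^ 2)⁻¹) := by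
        gcongr
        exact hexp.trans (inv_anti₀ (by positivity) h1)
    _ = 2 / 81 := by field_simp
    _ ≤ 1 / 40 := by norm_num

theorem rounds_mul_half_pow_le {L n : ℕ} {g : ℝ} (hn : 0 < n) (hg : 1 ≤ g) (hgn : g ^ 3 = n)
    (hL : (L : ℝ) ≤ 65 * g) :
    L * (1 / 2 : ℝ) ^ ⌈20 * Real.log ((n : ℝ) + 2)⌉₊ ≤ 1 / 40 := by
  have hn' : (0 : ℝ) < n := by exact_mod_cast hn
  have hn1 : (1 : ℝ) ≤ n := by exact_mod_cast hn
  have hℓ := one_le_log_add_two hn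
  have hhalf : (1 / 2 : ℝ) ^ ⌈20 * Real.log ((n : ℝ) + 2)⌉₊ ≤ (((n : ℝ) + 2) ^ 10)⁻¹ := by
    rw [← exp_neg_mul_log_add_two]
    have e : (1 / 2 : ℝ) ^ ⌈20 * Real.log ((n : ℝ) + 2)⌉₊
        = Real.exp (-(⌈20 * Real.log ((n : ℝ) + 2)⌉₊ * Real.log 2)) := by
      rw [Real.exp_neg, Real.exp_nat_mul, Real.exp_log (by norm_num), one_div, inv_pow]
    rw [e]
    apply Real.exp_le_exp.2
    have h1 := Nat.le_ceil (20 * Real.log ((n : ℝ) + 2))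
    have h2 := Real.log_two_gt_d9
    have h3 := mul_le_mul h1 (by linarith : (1 / 2 : ℝ) ≤ Real.log 2) (by norm_num)
      (Nat.cast_nonneg _)
    push_cast
    linarith
  have hgn' : g ≤ n := by
    rw [← hgn]
    exact le_self_pow₀ hg (by norm_num)
  have h1 : (2600 : ℝ) * n ≤ ((n : ℝ) + 2) ^ 10 := by
    calc (2600 : ℝ) * n ≤ 3 ^ 9 * n := by gcongr; norm_num
      _ ≤ ((n : ℝ) + 2) ^ 9 * ((n : ℝ) + 2) := by gcongr <;> linarith
      _ = _ := by ring
  calc (L : ℝ) * (1 / 2 : ℝ) ^ ⌈20 * Real.log ((n : ℝ) + 2)⌉₊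
      ≤ (65 * n) * (2600 * (n : ℝ))⁻¹ := by
        apply mul_le_mul _ _ (by positivity) (by positivity)
        · linarith
        · exact hhalf.trans (inv_anti₀ (by positivity) h1)
    _ = 1 / 40 := by field_simp; norm_num

/-- The size of a batch that resolves the threshold against a variance of `W N`. -/
theorem ceil_testSamples_le {N n k : ℕ} {η ρ g : ℝ} (hη : 0 < η) (hn : 0 < n) (hN : 0 < N)
    (hρ : 0 < ρ) (hg : 0 < g) (hgn : g ^ 3 = n) (hk : 0 < k)
    (hkq : N ^ 2 * ρ ^ 2 / g ^ 2 ≤ k) :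
    (⌈16 * (4 / η * (N / n) * N) / (3 / 64 * √(k : ℝ) / (N * ρ ^ 2)) ^ 2⌉₊ : ℝ)
      ≤ 1 + 30000 / η * (N ^ 2 * ρ ^ 2 / g) := by
  have hn' : (0 : ℝ) < n := by exact_mod_cast hn
  have hN' : (0 : ℝ) < N := by exact_mod_cast hN
  have hk' : (0 : ℝ) < k := by exact_mod_cast hk
  refine (Nat.ceil_lt_add_one (by positivity)).le.trans ?_
  have h2 : 16 * (4 / η * (N / n) * N) / (3 / 64 * √(k : ℝ) / (N * ρ ^ 2)) ^ 2
      = 262144 / 9 / η * (N ^ 2 * ρ ^ 2 / g) * (N ^ 2 * ρ ^ 2 / g ^ 2 / k) := by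
    rw [div_pow, mul_pow, Real.sq_sqrt hk'.le, ← hgn]
    field_simp
    norm_num
  have h3 : N ^ 2 * ρ ^ 2 / g ^ 2 / k ≤ 1 := div_le_one_of_le₀ hkq hk'.le
  have h4 : 262144 / 9 / η * (N ^ 2 * ρ ^ 2 / g) * (N ^ 2 * ρ ^ 2 / g ^ 2 / k)
      ≤ 262144 / 9 / η * (N ^ 2 * ρ ^ 2 / g) := mul_le_of_le_one_right (by positivity) h3
  have h5 : 262144 / 9 / η * (N ^ 2 * ρ ^ 2 / g) ≤ 30000 / η * (N ^ 2 * ρ ^ 2 / g) := by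
    gcongr; norm_num
  linarith

/-- The parameters of a stage that learns `L` sign vectors from `k` samples each; `ℓ` is the
logarithmic factor of localization and amplification, and `V` bounds the variance of the test
statistic for one sample. -/
def stageParams (ℓ V thr : ℝ) (k L : ℕ) : StageParams where
  locSamples := ⌈48 * ℓ⌉₊ * k
  locTol := 1 / (2 * √k)
  rounds := L
  learnSamples := k
  reps := ⌈20 * ℓ⌉₊
  testSamples := ⌈16 * V / thr ^ 2⌉₊
  testThreshold := thr

theorem card_sampleIdx_stageParams (ℓ V thr : ℝ) (k L : ℕ) :
    (Fintype.card (stageParams ℓ V thr k L).SampleIdx : ℝ)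
      = ⌈48 * ℓ⌉₊ * k + (L * k + ⌈20 * ℓ⌉₊ * ⌈16 * V / thr ^ 2⌉₊) := by
  simp [stageParams]

/-- The error probabilities of a stage with these parameters. -/
theorem stageParams_error_le {N n k L : ℕ} {W ρ g thr : ℝ} (hn : 0 < n) (hN : 0 < N)
    (hNn : N ≤ n ^ 2) (hW : 0 < W) (hk : 0 < k) (hL : 0 < L) (hg : 1 ≤ g) (hgn : g ^ 3 = n)
    (hLg : (L : ℝ) ≤ 65 * g) (hthr : 0 < thr) (hlearn : LearnsWith k L N W ρ thr)
    {ι Ω : Type} [Fintype ι] [Fintype Ω] [MeasurableSpace Ω] [MeasurableSingletonClass Ω]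
    (P : Measure Ω) [IsProbabilityMeasure P] {obs : ι → Ω → ℝ} {mean : ι → ℝ}
    (hin : StageInput P obs mean N W) :
    let s := stageParams (Real.log ((n : ℝ) + 2)) (W * N) thr k L
    ((∀ i, bias P obs mean i = 0) →
      (stageLaw P s mean).real {z | s.Rejects obs mean z.1 z.2} ≤ 1 / 20) ∧
    (1 / ρ ≤ ∑ i, |bias P obs mean i| →
      (stageLaw P s mean).real {z | ¬ s.Rejects obs mean z.1 z.2} ≤ 1 / 10) := by
  intro s
  have hN' : (0 : ℝ) < N := by exact_mod_cast hN
  have hN1 : (1 : ℝ) ≤ N := by exact_mod_cast hN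
  have hL1 : (1 : ℝ) ≤ L := by exact_mod_cast hL
  have hk' : (0 : ℝ) < k := by exact_mod_cast hk
  have hr0 : 0 < √(k : ℝ) := Real.sqrt_pos.2 hk'
  have hℓ := one_le_log_add_two hn
  have hMpos : 0 < s.locSamples := Nat.mul_pos (Nat.ceil_pos.2 (by positivity)) hk
  have hτpos : 0 < s.locTol := by
    change 0 < 1 / (2 * √(k : ℝ)); positivity
  have hm0 : 0 < s.testSamples := Nat.ceil_pos.2 (by positivity)
  have hm' : (0 : ℝ) < s.testSamples := by exact_mod_cast hm0
  have hloc : N * (2 * Real.exp (-(s.locSamples * s.locTol ^ 2 / 2))) ≤ 1 / 40 :=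
    mul_exp_locSamples_le hn hNn hk
  have hrounds : s.rounds * (1 / 2 : ℝ) ^ s.reps ≤ 1 / 40 :=
    rounds_mul_half_pow_le hn hg hgn hLg
  have hreps : (1 / 2 : ℝ) ^ s.reps ≤ 1 / 40 :=
    le_trans (le_mul_of_one_le_left (by positivity) hL1) hrounds
  have hsmall : W * N / (s.testSamples * s.testThreshold ^ 2) ≤ 1 / 16 := by
    have h1 : 16 * (W * N) / thr ^ 2 ≤ (s.testSamples : ℝ) := Nat.le_ceil _
    change W * N / (s.testSamples * thr ^ 2) ≤ 1 / 16
    rw [div_le_iff₀ (by positivity)] at h1 ⊢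
    linarith
  have : Fact (∀ i, |mean i| ≤ 1) := ⟨hin.abs_mean⟩
  have hcard : (Fintype.card ι : ℝ) ≤ N := by exact_mod_cast hin.card_le
  have hV : ∀ Γ : ι → ℝ, (∀ i, |Γ i| = 1) →
      variance (fun x => ∑ i, Γ i * obs i x) P ≤ W * N := by
    intro Γ hΓ
    refine (hin.variance_le Γ).trans (mul_le_mul_of_nonneg_left ?_ hW.le)
    have : ∀ i, Γ i ^ 2 = 1 := fun i => by rw [← sq_abs, hΓ, one_pow]
    simpa [this] using hcard
  constructor
  · intro hb
    exact stage_rejects_le P s hin.abs_obs (fun i => sub_eq_zero.1 (hb i)) hMpos hτpos.le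
      (le_trans (mul_le_mul_of_nonneg_right hcard (by positivity)) hloc) hm0 hthr hV hsmall hrounds
  · intro hfar
    by_cases hbig : ∃ i, 2 * s.locTol ≤ |bias P obs mean i|
    · obtain ⟨i, hi⟩ := hbig
      refine stage_not_rejects_le_of_bias P s hin.abs_obs hi hMpos hτpos ?_
      have := le_mul_of_one_le_left (by positivity :
        0 ≤ 2 * Real.exp (-(s.locSamples * s.locTol ^ 2 / 2))) hN1
      linarith
    · push Not at hbig
      have hlocal : ∀ i, |bias P obs mean i| * √k ≤ 1 := by
        intro i
        have h1 : |bias P obs mean i| < 2 * (1 / (2 * √(k : ℝ))) := hbig i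
        have e : 2 * (1 / (2 * √(k : ℝ))) = 1 / √(k : ℝ) := by field_simp
        rw [e, lt_div_iff₀ hr0] at h1
        exact h1.le
      obtain ⟨r, hr, hexp⟩ := hlearn ι Ω P obs mean hin hlocal hfar
      exact stage_not_rejects_le_of_rounds P s hm0 hthr hV hsmall hr hexp hreps

/-- **The parameters of a stage.** The constant depends on the gap only; `N` bounds the number of
observables, `1 / ρ` is the total bias to be detected, and `g = n^{1/3}`. -/
theorem exists_stageParams {η : ℝ} (hη : 0 < η) :
    ∃ C : ℝ, 0 < C ∧ ∀ (N n : ℕ) (ρ g : ℝ), 0 < n → n ≤ N → N ≤ n ^ 2 → 0 < ρ → 1 ≤ g →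
      g ^ 3 = n → ∃ s : StageParams,
        (Fintype.card s.SampleIdx : ℝ)
          ≤ C * Real.log ((n : ℝ) + 2) * (1 + N ^ 2 * ρ ^ 2 / g) ∧
        (s.rounds : ℝ) ≤ C * g ∧
        ∀ (ι Ω : Type) [Fintype ι] [Fintype Ω] [MeasurableSpace Ω] [MeasurableSingletonClass Ω]
          (P : Measure Ω) [IsProbabilityMeasure P] (obs : ι → Ω → ℝ) (mean : ι → ℝ),
          StageInput P obs mean N (4 / η * (N / n)) →
          ((∀ i, bias P obs mean i = 0) →
            (stageLaw P s mean).real {z | s.Rejects obs mean z.1 z.2} ≤ 1 / 20) ∧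
          (1 / ρ ≤ ∑ i, |bias P obs mean i| →
            (stageLaw P s mean).real {z | ¬ s.Rejects obs mean z.1 z.2} ≤ 1 / 10) := by
  have hη1 : 0 < 1 / η := by positivity
  have hη2 : 0 < 30000 / η := by positivity
  refine ⟨49 + 65 * (1 + 456 * (1 + 1 / η)) + 21 * (1 + 30000 / η), by positivity, ?_⟩
  intro N n ρ g hn hnN hNn hρ hg hgn
  obtain ⟨k, L, hk0, hL0, hk1, hkq, hLg, hLk, hlearn⟩ := exists_learnsWith hη hn hnN hρ hg hgn
  have hn' : (0 : ℝ) < n := by exact_mod_cast hn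
  have hN : 0 < N := hn.trans_le hnN
  have hN' : (0 : ℝ) < N := by exact_mod_cast hN
  have hk' : (0 : ℝ) < k := by exact_mod_cast hk0
  have hr0 : 0 < √(k : ℝ) := Real.sqrt_pos.2 hk'
  have hg0 : 0 < g := by linarith
  have hℓ := one_le_log_add_two hn
  have hm := ceil_testSamples_le hη hn hN hρ hg0 hgn hk0 hkq
  refine ⟨stageParams (Real.log ((n : ℝ) + 2)) (4 / η * (N / n) * N)
    (3 / 64 * √k / (N * ρ ^ 2)) k L, ?_, ?_, ?_⟩
  · rw [card_sampleIdx_stageParams]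
    generalize Real.log ((n : ℝ) + 2) = ℓ at hℓ
    have hB0 : 0 ≤ (N : ℝ) ^ 2 * ρ ^ 2 / g := by positivity
    generalize (N : ℝ) ^ 2 * ρ ^ 2 / g = B at hk1 hLk hm hB0
    have hceil : ∀ c : ℕ, (⌈c * ℓ⌉₊ : ℝ) ≤ (c + 1) * ℓ := by
      intro c
      have := (Nat.ceil_lt_add_one (by positivity : 0 ≤ c * ℓ)).le
      linarith
    have c1 := hceil 48
    have c2 := hceil 20
    push_cast at c1 c2
    have t1 : (⌈48 * ℓ⌉₊ : ℝ) * k ≤ (48 + 1) * ℓ * (1 + B) :=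
      mul_le_mul c1 hk1 hk'.le (by positivity)
    have t2 : (L * k : ℝ) ≤ 65 * (1 + 456 * (1 + 1 / η)) * ℓ * (1 + B) :=
      hLk.trans (mul_le_mul_of_nonneg_right (le_mul_of_one_le_right (by positivity) hℓ)
        (by positivity))
    have t3 := mul_le_mul c2 (hm.trans
      (by nlinarith [mul_nonneg hη2.le hB0] : 1 + 30000 / η * B ≤ (1 + 30000 / η) * (1 + B)))
      (Nat.cast_nonneg _) (by positivity)
    refine (add_le_add t1 (add_le_add t2 t3)).trans (le_of_eq ?_)
    ring
  · change (L : ℝ) ≤ _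
    refine hLg.trans (mul_le_mul_of_nonneg_right ?_ hg0.le)
    linarith
  · intro ι Ω _ _ _ _ P _ obs mean hin
    exact stageParams_error_le hn hN hNn (by positivity) hk0 hL0 hg hgn hLg (by positivity)
      hlearn P hin

end Parameters

/-! ### The two stages together -/

section Algorithm
variable {n : ℕ}

/-- Regrouping the samples and the internal randomness of the algorithm by the two stages. -/
def runEquiv (a : LTTParams) (n : ℕ) :
    ((a.SampleIdx → Config n) × a.Seed n) ≃
      ((a.node.SampleIdx → Config n) × a.node.Seed (Fin n)) ×
        ((a.edge.SampleIdx → Config n) × a.edge.Seed (Edge n)) where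
  toFun ω := ((fun k => ω.1 (Sum.inl k), ω.2.1), (fun k => ω.1 (Sum.inr k), ω.2.2))
  invFun y := (Sum.elim y.1.1 y.2.1, (y.1.2, y.2.2))
  left_inv := by
    rintro ⟨x, r⟩
    refine Prod.ext ?_ rfl
    funext k
    rcases k with k | k <;> rfl
  right_inv _ := rfl

theorem runEquiv_symm_apply (a : LTTParams)
    (y : ((a.node.SampleIdx → Config n) × a.node.Seed (Fin n)) ×
        ((a.edge.SampleIdx → Config n) × a.edge.Seed (Edge n))) :
    (runEquiv a n).symm y = (Sum.elim y.1.1 y.2.1, (y.1.2, y.2.2)) := rfl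

namespace IsingModel

theorem abs_integral_le_one (q : IsingModel n) {f : Config n → ℝ} (hf : ∀ x, |f x| = 1) :
    |∫ x, f x ∂q.law| ≤ 1 := by
  refine (norm_integral_le_of_norm_le_const (C := 1)
    (Filter.Eventually.of_forall fun x => (Real.norm_eq_abs _).trans_le (hf x).le)).trans ?_
  simp

instance fact_nodeMean (q : IsingModel n) : Fact (∀ v, |q.nodeMean v| ≤ 1) :=
  ⟨fun v => q.abs_integral_le_one (abs_nodeObs v)⟩

instance fact_edgeMean (q : IsingModel n) : Fact (∀ e, |q.edgeMean e| ≤ 1) :=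
  ⟨fun e => q.abs_integral_le_one (abs_edgeObs e)⟩

end IsingModel

theorem measurePreserving_runEquiv (a : LTTParams) (p q : IsingModel n) :
    MeasurePreserving (runEquiv a n) (a.runLaw p q)
      ((stageLaw p.law a.node q.nodeMean).prod (stageLaw p.law a.edge q.edgeMean)) := by
  refine measurePreserving_of_singleton _ fun y => ?_
  obtain ⟨⟨x, r⟩, ⟨x', r'⟩⟩ := y
  rw [runEquiv_symm_apply]
  simp only [LTTParams.runLaw, stageLaw, prod_singleton_eq_mul, Measure.pi_singleton]
  rw [Fintype.prod_sum_type]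
  simp only [Sum.elim_inl, Sum.elim_inr]
  ring

theorem outputProb_far (a : LTTParams) (p q : IsingModel n) :
    a.outputProb p q Verdict.far
      = ((stageLaw p.law a.node q.nodeMean).prod (stageLaw p.law a.edge q.edgeMean)).real
        {y | a.node.Rejects nodeObs q.nodeMean y.1.1 y.1.2 ∨
          a.edge.Rejects edgeObs q.edgeMean y.2.1 y.2.2} := by
  rw [← real_preimage_of_measurePreserving (measurePreserving_runEquiv a p q)
    (fun y => a.node.Rejects nodeObs q.nodeMean y.1.1 y.1.2 ∨
          a.edge.Rejects edgeObs q.edgeMean y.2.1 y.2.2), LTTParams.outputProb]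
  congr 1
  ext ω
  change a.output q.nodeMean q.edgeMean ω = Verdict.far ↔
    (a.node.Rejects nodeObs q.nodeMean (fun k => ω.1 (Sum.inl k)) ω.2.1 ∨
      a.edge.Rejects edgeObs q.edgeMean (fun k => ω.1 (Sum.inr k)) ω.2.2)
  unfold LTTParams.output
  split_ifs with h1 h2
  · simp [h1]
  · simp [h2]
  · simp [h1, h2]

theorem outputProb_same (a : LTTParams) (p q : IsingModel n) :
    a.outputProb p q Verdict.same = 1 - a.outputProb p q Verdict.far := by
  have : IsProbabilityMeasure (a.runLaw p q) := by unfold LTTParams.runLaw; infer_instance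
  rw [LTTParams.outputProb, LTTParams.outputProb,
    ← probReal_compl_eq_one_sub (Set.toFinite _).measurableSet]
  congr 1
  ext ω
  change a.output q.nodeMean q.edgeMean ω = Verdict.same ↔
    ¬ a.output q.nodeMean q.edgeMean ω = Verdict.far
  cases a.output q.nodeMean q.edgeMean ω <;> simp

theorem outputProb_far_le (a : LTTParams) (p q : IsingModel n) :
    a.outputProb p q Verdict.far
      ≤ (stageLaw p.law a.node q.nodeMean).real {z | a.node.Rejects nodeObs q.nodeMean z.1 z.2}
        + (stageLaw p.law a.edge q.edgeMean).real
          {z | a.edge.Rejects edgeObs q.edgeMean z.1 z.2} := by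
  rw [outputProb_far,
    ← real_preimage_of_measurePreserving (measurePreserving_fst
      (μ := stageLaw p.law a.node q.nodeMean) (ν := stageLaw p.law a.edge q.edgeMean))
      (fun z => a.node.Rejects nodeObs q.nodeMean z.1 z.2),
    ← real_preimage_of_measurePreserving (measurePreserving_snd
      (μ := stageLaw p.law a.node q.nodeMean) (ν := stageLaw p.law a.edge q.edgeMean))
      (fun z => a.edge.Rejects edgeObs q.edgeMean z.1 z.2)]
  exact measureReal_union_le _ _

theorem le_outputProb_far_of_node (a : LTTParams) (p q : IsingModel n)
    (h : (stageLaw p.law a.node q.nodeMean).real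
      {z | ¬ a.node.Rejects nodeObs q.nodeMean z.1 z.2} ≤ 1 / 10) :
    9 / 10 ≤ a.outputProb p q Verdict.far := by
  rw [← real_preimage_of_measurePreserving (measurePreserving_fst
      (μ := stageLaw p.law a.node q.nodeMean) (ν := stageLaw p.law a.edge q.edgeMean))
      (fun z => ¬ a.node.Rejects nodeObs q.nodeMean z.1 z.2)] at h
  rw [outputProb_far, ← compl_compl {y : ((a.node.SampleIdx → Config n) × a.node.Seed (Fin n)) ×
        ((a.edge.SampleIdx → Config n) × a.edge.Seed (Edge n)) | _ ∨ _},
    probReal_compl_eq_one_sub (Set.toFinite _).measurableSet]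
  have := (measureReal_mono (μ := (stageLaw p.law a.node q.nodeMean).prod
    (stageLaw p.law a.edge q.edgeMean))
    (s₁ := {y | a.node.Rejects nodeObs q.nodeMean y.1.1 y.1.2 ∨
          a.edge.Rejects edgeObs q.edgeMean y.2.1 y.2.2}ᶜ)
    (fun y hy hn => hy (Or.inl hn))).trans h
  linarith

theorem le_outputProb_far_of_edge (a : LTTParams) (p q : IsingModel n)
    (h : (stageLaw p.law a.edge q.edgeMean).real
      {z | ¬ a.edge.Rejects edgeObs q.edgeMean z.1 z.2} ≤ 1 / 10) :
    9 / 10 ≤ a.outputProb p q Verdict.far := by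
  rw [← real_preimage_of_measurePreserving (measurePreserving_snd
      (μ := stageLaw p.law a.node q.nodeMean) (ν := stageLaw p.law a.edge q.edgeMean))
      (fun z => ¬ a.edge.Rejects edgeObs q.edgeMean z.1 z.2)] at h
  rw [outputProb_far, ← compl_compl {y : ((a.node.SampleIdx → Config n) × a.node.Seed (Fin n)) ×
        ((a.edge.SampleIdx → Config n) × a.edge.Seed (Edge n)) | _ ∨ _},
    probReal_compl_eq_one_sub (Set.toFinite _).measurableSet]
  have := (measureReal_mono (μ := (stageLaw p.law a.node q.nodeMean).prod
    (stageLaw p.law a.edge q.edgeMean))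
    (s₁ := {y | a.node.Rejects nodeObs q.nodeMean y.1.1 y.1.2 ∨
          a.edge.Rejects edgeObs q.edgeMean y.2.1 y.2.2}ᶜ)
    (fun y hy hn => hy (Or.inr hn))).trans h
  linarith

end Algorithm

section Main
variable {n : ℕ}

theorem stageInput_node (p q : IsingModel n) {η : ℝ} (hη : 0 < η) (hp : p.HighTemperature η)
    (hn : 0 < n) : StageInput p.law nodeObs q.nodeMean n (4 / η * ((n : ℕ) / n)) where
  card_le := by simp
  abs_obs := abs_nodeObs
  abs_mean := (IsingModel.fact_nodeMean q).out
  variance_le a := by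
    rw [div_self (by exact_mod_cast hn.ne'), mul_one]
    exact p.variance_node_le hη hp hn a

theorem stageInput_edge (p q : IsingModel n) {η : ℝ} (hη : 0 < η) (hp : p.HighTemperature η)
    (hn : 0 < n) :
    StageInput p.law edgeObs q.edgeMean (n ^ 2) (4 / η * ((n ^ 2 : ℕ) / n)) where
  card_le := card_edge_le n
  abs_obs := abs_edgeObs
  abs_mean := (IsingModel.fact_edgeMean q).out
  variance_le a := by
    have hn' : (n : ℝ) ≠ 0 := by exact_mod_cast hn.ne'
    have e : 4 / η * (((n ^ 2 : ℕ) : ℝ) / n) = 4 / η * n := by push_cast; field_simp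
    rw [e]
    exact p.variance_edge_le hη hp hn a

/-- The scale `ρ = max (4 c / ε) (1 / N)` at which a stage is run detects a total bias `D` that
contributes at least half of `ε` to the divergence. -/
theorem one_div_scale_le {c D ε N : ℝ} (hε : 0 < ε) (hN : 0 < N)
    (h : ε / 2 ≤ 2 * c * D) (hD : 0 ≤ D) : 1 / max (4 * c / ε) (1 / N) ≤ D := by
  have hρ : 0 < max (4 * c / ε) (1 / N) := lt_max_of_lt_right (by positivity)
  rw [div_le_iff₀ hρ]
  have h1 : 1 ≤ D * (4 * c / ε) := by
    rw [mul_div_assoc', le_div_iff₀ hε]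
    linarith
  exact h1.trans (mul_le_mul_of_nonneg_left (le_max_left _ _) hD)

theorem scale_sq_le (c ε N : ℝ) :
    max (4 * c / ε) (1 / N) ^ 2 ≤ 16 * c ^ 2 / ε ^ 2 + 1 / N ^ 2 := by
  have e1 : (4 * c / ε) ^ 2 = 16 * c ^ 2 / ε ^ 2 := by rw [div_pow, mul_pow]; norm_num
  have e2 : (1 / N) ^ 2 = 1 / N ^ 2 := by rw [div_pow, one_pow]
  have h1 : 0 ≤ (4 * c / ε) ^ 2 := sq_nonneg _
  have h2 : 0 ≤ (1 / N) ^ 2 := sq_nonneg _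
  rw [← e1, ← e2]
  rcases max_cases (4 * c / ε) (1 / N) with ⟨h, _⟩ | ⟨h, _⟩ <;> rw [h] <;> linarith

/-- The empty graph carries a single distribution, so that the algorithm needs no samples. -/
theorem exists_params_zero :
    ∃ a : LTTParams, a.sampleCount = 0 ∧ a.node.rounds = 0 ∧ a.edge.rounds = 0 ∧
      ∀ p q : IsingModel 0, a.outputProb p q Verdict.far = 0 ∧ dSKL p.law q.law = 0 := by
  let s : StageParams := ⟨0, 0, 0, 0, 0, 0, 0⟩
  refine ⟨⟨s, s⟩, by simp [LTTParams.sampleCount, s], rfl, rfl, fun p q => ⟨?_, ?_⟩⟩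
  · have hmt : ∀ (ι : Type) [Fintype ι] [IsEmpty ι] (obs : ι → Config 0 → ℝ) (mean : ι → ℝ)
        (x : s.SampleIdx → Config 0) (r : s.Seed ι), ¬ s.Rejects obs mean x r := by
      rintro ι _ _ obs mean x r (⟨i, _⟩ | ⟨l, _⟩)
      · exact isEmptyElim i
      · exact l.elim0
    have : IsEmpty (Edge 0) := ⟨fun e => e.1.1.elim0⟩
    rw [outputProb_far]
    simp [hmt]
  · rw [IsingModel.dSKL_law]
    have : IsEmpty (Edge 0) := ⟨fun e => e.1.1.elim0⟩
    simp

end Main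

end IsingTest

end

theorem mainTheorem11 (η : ℝ) (hη : 0 < η) :
    ∃ (C : ℝ) (κ : ℕ), 0 < C ∧
      ∀ (n : ℕ) (ε h β : ℝ), 0 < ε → 0 ≤ h → 0 ≤ β →
        ∃ a : IsingTest.LTTParams,
          (a.sampleCount : ℝ) ≤
              C * Real.log ((n : ℝ) + 2) ^ κ *
                (1 + ((n : ℝ) ^ (5 / 3 : ℝ) * h ^ 2 + (n : ℝ) ^ (11 / 3 : ℝ) * β ^ 2) / ε ^ 2) ∧
            (a.node.rounds : ℝ) ≤ C * (n : ℝ) ^ (1 / 3 : ℝ) ∧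
            (a.edge.rounds : ℝ) ≤ C * (n : ℝ) ^ (1 / 3 : ℝ) ∧
            ∀ p q : IsingTest.IsingModel n,
              p.HighTemperature η → q.HighTemperature η →
              p.BoundedBy h β → q.BoundedBy h β →
                (p.law = q.law → 9 / 10 ≤ a.outputProb p q IsingTest.Verdict.same) ∧
                (ENNReal.ofReal ε ≤ IsingTest.dSKL p.law q.law →
                  9 / 10 ≤ a.outputProb p q IsingTest.Verdict.far) := by
  open IsingTest in
  obtain ⟨C, hC, hstage⟩ := exists_stageParams hη
  refine ⟨16 * C, 1, by positivity, ?_⟩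
  intro n ε h β hε hh hβ
  have hlog : 0 < Real.log ((n : ℝ) + 2) :=
    Real.log_pos (by linarith [(Nat.cast_nonneg n : (0 : ℝ) ≤ n)])
  rcases Nat.eq_zero_or_pos n with rfl | hn
  · obtain ⟨a, ha, ha1, ha2, hout⟩ := exists_params_zero
    refine ⟨a, ?_, ?_, ?_, fun p q _ _ _ _ => ⟨fun _ => ?_, fun hfar => ?_⟩⟩
    · rw [ha, Nat.cast_zero]; positivity
    · rw [ha1, Nat.cast_zero]; positivity
    · rw [ha2, Nat.cast_zero]; positivity
    · rw [outputProb_same, (hout p q).1]; norm_num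
    · rw [(hout p q).2, nonpos_iff_eq_zero, ENNReal.ofReal_eq_zero] at hfar
      exact absurd hfar (not_le.2 hε)
  have hn' : (0 : ℝ) < n := by exact_mod_cast hn
  have hn1 : (1 : ℝ) ≤ n := by exact_mod_cast hn
  have hnsq : n ≤ n ^ 2 := Nat.le_self_pow (by norm_num) n
  set g : ℝ := (n : ℝ) ^ (1 / 3 : ℝ) with hg
  have hg1 : 1 ≤ g := Real.one_le_rpow hn1 (by norm_num)
  have hg0 : 0 < g := by linarith
  have hgpow : ∀ m : ℕ, g ^ m = (n : ℝ) ^ (m / 3 : ℝ) := by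
    intro m
    rw [hg, ← Real.rpow_natCast, ← Real.rpow_mul hn'.le]
    congr 1
    ring
  have hg3 : g ^ 3 = n := by rw [hgpow]; norm_num
  have hg5 : (n : ℝ) ^ (5 / 3 : ℝ) = g ^ 5 := by rw [hgpow]; norm_num
  have hg11 : (n : ℝ) ^ (11 / 3 : ℝ) = g ^ 11 := by rw [hgpow]; norm_num
  have hN2 : (0 : ℝ) < (n ^ 2 : ℕ) := by positivity
  obtain ⟨s, hs, hsr, hserr⟩ := hstage n n (max (4 * h / ε) (1 / n)) g hn le_rfl hnsq
    (lt_max_of_lt_right (by positivity)) hg1 hg3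
  obtain ⟨t, ht, htr, hterr⟩ := hstage (n ^ 2) n (max (4 * β / ε) (1 / (n ^ 2 : ℕ))) g hn hnsq
    le_rfl (lt_max_of_lt_right (by positivity)) hg1 hg3
  refine ⟨⟨s, t⟩, ?_, ?_, ?_, ?_⟩
  · have hcount : ((LTTParams.sampleCount ⟨s, t⟩ : ℕ) : ℝ)
        = Fintype.card s.SampleIdx + Fintype.card t.SampleIdx := by
      exact_mod_cast Fintype.card_sum (α := s.SampleIdx) (β := t.SampleIdx)
    have hb1 : (n : ℝ) ^ 2 * max (4 * h / ε) (1 / n) ^ 2 / g ≤ 16 * (g ^ 5 * h ^ 2 / ε ^ 2) + 1 := by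
      have h1 := mul_le_mul_of_nonneg_left (scale_sq_le h ε n)
        (by positivity : 0 ≤ (n : ℝ) ^ 2 / g)
      have h2 : (n : ℝ) ^ 2 / g * (16 * h ^ 2 / ε ^ 2 + 1 / (n : ℝ) ^ 2)
          = 16 * (g ^ 5 * h ^ 2 / ε ^ 2) + 1 / g := by
        rw [← hg3]; field_simp
      have h3 : 1 / g ≤ 1 := (div_le_one hg0).2 hg1
      have h4 : (n : ℝ) ^ 2 * max (4 * h / ε) (1 / n) ^ 2 / g
        = (n : ℝ) ^ 2 / g * max (4 * h / ε) (1 / n) ^ 2 := by ring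
      linarith
    have hb2 : ((n ^ 2 : ℕ) : ℝ) ^ 2 * max (4 * β / ε) (1 / (n ^ 2 : ℕ)) ^ 2 / g
        ≤ 16 * (g ^ 11 * β ^ 2 / ε ^ 2) + 1 := by
      have h1 := mul_le_mul_of_nonneg_left (scale_sq_le β ε (n ^ 2 : ℕ))
        (by positivity : 0 ≤ ((n ^ 2 : ℕ) : ℝ) ^ 2 / g)
      have h2 : ((n ^ 2 : ℕ) : ℝ) ^ 2 / g * (16 * β ^ 2 / ε ^ 2 + 1 / ((n ^ 2 : ℕ) : ℝ) ^ 2)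
          = 16 * (g ^ 11 * β ^ 2 / ε ^ 2) + 1 / g := by
        push_cast
        rw [← hg3]; field_simp
      have h3 : 1 / g ≤ 1 := (div_le_one hg0).2 hg1
      have h4 : ((n ^ 2 : ℕ) : ℝ) ^ 2 * max (4 * β / ε) (1 / (n ^ 2 : ℕ)) ^ 2 / g
        = ((n ^ 2 : ℕ) : ℝ) ^ 2 / g * max (4 * β / ε) (1 / (n ^ 2 : ℕ)) ^ 2 := by ring
      linarith
    have hCl : 0 ≤ C * Real.log ((n : ℝ) + 2) := by positivity
    have h1 := hs.trans (mul_le_mul_of_nonneg_left (add_le_add (le_refl (1 : ℝ)) hb1) hCl)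
    have h2 := ht.trans (mul_le_mul_of_nonneg_left (add_le_add (le_refl (1 : ℝ)) hb2) hCl)
    rw [hcount, hg5, hg11, pow_one]
    refine (add_le_add h1 h2).trans ?_
    have e : 16 * C * Real.log ((n : ℝ) + 2) * (1 + (g ^ 5 * h ^ 2 + g ^ 11 * β ^ 2) / ε ^ 2)
        = C * Real.log ((n : ℝ) + 2) * (1 + (16 * (g ^ 5 * h ^ 2 / ε ^ 2) + 1))
          + C * Real.log ((n : ℝ) + 2) * (1 + (16 * (g ^ 11 * β ^ 2 / ε ^ 2) + 1))
          + 12 * (C * Real.log ((n : ℝ) + 2)) := by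
      ring
    linarith
  · exact hsr.trans (mul_le_mul_of_nonneg_right (by linarith) hg0.le)
  · exact htr.trans (mul_le_mul_of_nonneg_right (by linarith) hg0.le)
  · intro p q hp hq hpb hqb
    have hnode := hserr (Fin n) (Config n) p.law nodeObs q.nodeMean (stageInput_node p q hη hp hn)
    have hedge := hterr (Edge n) (Config n) p.law edgeObs q.edgeMean
      (stageInput_edge p q hη hp hn)
    constructor
    · intro heq
      have h1 := hnode.1 fun v => by rw [bias, heq]; exact sub_self _
      have h2 := hedge.1 fun e => by rw [bias, heq]; exact sub_self _
      have h3 := outputProb_far_le ⟨s, t⟩ p q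
      rw [outputProb_same]
      linarith
    · intro hfar
      have hsum := IsingModel.le_of_le_dSKL hpb hqb hfar hε
      by_cases hcase : ε / 2 ≤ 2 * h * ∑ v, |p.nodeMean v - q.nodeMean v|
      · exact le_outputProb_far_of_node ⟨s, t⟩ p q (hnode.2 (one_div_scale_le hε hn' hcase
          (Finset.sum_nonneg fun _ _ => abs_nonneg _)))
      · have hcase' : ε / 2 ≤ 2 * β * ∑ e, |p.edgeMean e - q.edgeMean e| := by linarith
        exact le_outputProb_far_of_edge ⟨s, t⟩ p q (hedge.2 (one_div_scale_le hε hN2 hcase'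
          (Finset.sum_nonneg fun _ _ => abs_nonneg _)))
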